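/- **Theorem.** Let $q\ge 2$ and let $w$ be a word of length $k\ge 1$ over an alphabet of $q$ letters. For $1\le i\le k$ put $b_i=1$ if the prefix of $w$ of length $i$ equals the suffix of $w$ of length $i$, and $b_i=0$ otherwise. The autocorrelation of $w$ is the sequence $b_kb_{k-1}\dots b_1$; autocorrelations are compared as numbers written in base $2$. Put $$A_w(x)=b_kx^{k-1}+b_{k-1}x^{k-2}+\dots+b_1,\qquad P_w(x)=1+(x-q)A_w(x).$$ There are an integer $k_0$ and a constant $K$ (both absolute; in particular independent of $q$, $k$ and the words) such that the following holds for all $q\ge2$, all $k\ge k_0$ and all words $w,w'$ of the same length $k$ over an alphabet of $q$ letters such that the autocorrelation of $w$ is larger than that of $w'$. The polynomials $P_w$ and $P_{w'}$ have largest roots $\alpha$ and $\alpha'$, that is, real roots such that every other complex root of $P_w$ (respectively $P_{w'}$) has absolute value smaller than $\alpha$ (respectively $\alpha'$). Let $c_w$ be the coefficient of $\frac1{x-\alpha}$ in the partial fraction decomposition of $\frac1{P_w(x)}$ over $\mathbb C$, and $c_{w'}$ the coefficient of $\frac1{x-\alpha'}$ in that of $\frac1{P_{w'}(x)}$; both are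 real. Then there is exactly one real number $n=n^*$ with $c_w\alpha^{n}=c_{w'}(\alpha')^{n}$, and for some real $\theta$ with $|\theta|\le K\,k\,q^{-k/3+4}$, $$n^*=C_{A_w/A_{w'}}\cdot q\,A_w(q)\,(1+\theta)\ \ge\ \ln q\cdot q^{k-1}\,(1+\theta),$$ where $$C_{A_w/A_{w'}}=\ln\!\left(1+\frac{A_w(q)-A_{w'}(q)}{A_{w'}(q)}\right)\Big/\left(\frac{A_w(q)-A_{w'}(q)}{A_{w'}(q)}\right)\quad\text{and}\quad \frac{\ln q}{q}\le C_{A_w/A_{w'}}\le 1 .$$ -/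

import Mathlib

open Polynomial

noncomputable section

/-- `corrBit w i` is the autocorrelation bit `b_i`: it is `1` if the prefix of `w` of length `i`
equals the suffix of `w` of length `i`, and `0` otherwise (used for `1 ≤ i ≤ w.length`). -/
def corrBit {q : ℕ} (w : List (Fin q)) (i : ℕ) : ℕ :=
  if w.take i = w.drop (w.length - i) then 1 else 0

/-- The autocorrelation `b_k b_{k-1} … b_1` read as a number written in base `2`. -/
def corrValue {q : ℕ} (w : List (Fin q)) : ℕ :=
  ∑ i ∈ Finset.Icc 1 w.length, corrBit w i * 2 ^ (i - 1)

/-- The inverse autocorrelation polynomial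
`A_w(x) = b_k x^(k-1) + b_(k-1) x^(k-2) + … + b_1`. -/
def corrPoly {q : ℕ} (w : List (Fin q)) : ℝ[X] :=
  ∑ i ∈ Finset.Icc 1 w.length, C (corrBit w i : ℝ) * X ^ (i - 1)

/-- The recurrence polynomial `P_w(x) = 1 + (x - q) A_w(x)`. -/
def recPoly {q : ℕ} (w : List (Fin q)) : ℝ[X] :=
  1 + (X - C (q : ℝ)) * corrPoly w

/-- `α` is the largest root of `P`: it is a real root, and every other complex root of `P` has
absolute value smaller than `α`. There is at most one such `α`. -/
def IsLargestRoot (P : ℝ[X]) (α : ℝ) : Prop :=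
  P.IsRoot α ∧
    ∀ z : ℂ, (P.map (algebraMap ℝ ℂ)).IsRoot z → z ≠ (α : ℂ) → ‖z‖ < α

/-- The numbers `c a j`, for `a` a complex root of `P` and `1 ≤ j ≤` the multiplicity of `a`,
are the coefficients of the partial fraction decomposition of `1 / P`:
`1 / P(x) = ∑ c a j / (x - a)^j`. -/
def IsPartialFractionDecomp (P : ℂ[X]) (c : ℂ → ℕ → ℂ) : Prop :=
  ∀ x : ℂ, ¬ P.IsRoot x →
    1 / P.eval x =
      ∑ a ∈ P.roots.toFinset, ∑ j ∈ Finset.Icc 1 (P.rootMultiplicity a), c a j / (x - a) ^ j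

/-- `α` is the largest root of the recurrence polynomial `P_w`, and `cw` is the coefficient of
`1 / (x - α)` in the partial fraction decomposition of `1 / P_w(x)`. -/
def IsMainExponent {q : ℕ} (w : List (Fin q)) (α cw : ℝ) : Prop :=
  IsLargestRoot (recPoly w) α ∧
    ∃ c : ℂ → ℕ → ℂ,
      IsPartialFractionDecomp ((recPoly w).map (algebraMap ℝ ℂ)) c ∧ c (α : ℂ) 1 = (cw : ℂ)

/-- `relGap w w' = (A_w(q) - A_{w'}(q)) / A_{w'}(q)`. -/
def relGap {q : ℕ} (w w' : List (Fin q)) : ℝ :=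
  ((corrPoly w).eval (q : ℝ) - (corrPoly w').eval (q : ℝ)) / (corrPoly w').eval (q : ℝ)

/-- The constant `C_{A_w/A_{w'}} = ln (1 + r) / r` with `r = relGap w w'`. -/
def ratioConst {q : ℕ} (w w' : List (Fin q)) : ℝ :=
  Real.log (1 + relGap w w') / relGap w w'

end

/-! Write $Q=q^{k-1}$, and let $\alpha,\beta$ be the largest roots of $P_w,P_{w'}$. A root satisfies
$(q-\alpha)A_w(\alpha)=1$ and $A_w$ has size about $Q$ near $q$, so $\alpha$ lies within $2/Q$ of
$q$. Any other root of modulus at least $\alpha$ would also lie within $O(1/Q)$ of $q$, because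
$|A_w(z)|\ge|z|^{k-1}/4$ off a disc (`norm_eval_corrPoly_ge`); subtracting the two root equations
and using a Lipschitz bound for $A_w$ rules it out (`exists_isLargestRoot`). The root is simple, so
$c_w=1/P_w'(\alpha)$, and $n^*=\ln(G/H)/\ln(\alpha/\beta)$ with $G=P_w'(\alpha)$ and
$H=P_{w'}'(\beta)$.

Put $a=A_w(q)$, $b=A_{w'}(q)$, $\Delta=a-b$. Up to relative errors, $A_w(\alpha)-A_{w'}(\beta)$ and
$G-H$ are $\Delta$, and $H$ is $b$. The root equations give exactly
$\alpha-\beta=(A_w(\alpha)-A_{w'}(\beta))/(A_w(\alpha)A_{w'}(\beta))$, hence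
$\ln(\alpha/\beta)\approx\Delta/(abq)$, while $\ln(G/H)\approx\ln(1+\Delta/b)$. The quotient is the
claimed main term (`relClose_crossing`).

The delicate point is that $\Delta$ may be much smaller than $Q$, so errors must be measured against
$\Delta$. If $A_w-A_{w'}$ has degree $m$, its variation near $q$ is controlled by $kq^m$, and
`exists_corrPoly_gap` gives $q^m\le4q^{k/2}\Delta$. For $m$ above $k/2$ this is combinatorial: two
consecutive short periods force a constant word (`corrBit_eq_one_of_consecutive`), so the digits of
$w'$ just below $m$ cannot both be $1$ and cancel the gain at $m$. All errors are then
$O(kq^{k/2}/Q)$. -/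

/-! ### Size and Lipschitz bounds for polynomials with bounded coefficients. -/

theorem sum_range_pow_le_pow {R : ℝ} (hR : 2 ≤ R) (n : ℕ) :
    ∑ j ∈ Finset.range n, R ^ j ≤ R ^ n - 1 := by
  induction n with
  | zero => simp
  | succ n ih =>
    rw [Finset.sum_range_succ, pow_succ]
    nlinarith [pow_pos (by linarith : 0 < R) n]

section
variable {𝕜 : Type*} [NormedField 𝕜]

theorem norm_eval_le {p : 𝕜[X]} {n : ℕ} (hn : p.degree < n) {M R : ℝ}
    (hM : ∀ j, ‖p.coeff j‖ ≤ M) (hR : 2 ≤ R) {x : 𝕜} (hx : ‖x‖ ≤ R) :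
    ‖p.eval x‖ ≤ M * R ^ n := by
  have hM0 : 0 ≤ M := (norm_nonneg _).trans (hM 0)
  by_cases hp : p = 0
  · simp only [hp, eval_zero, norm_zero]; positivity
  rw [eval_eq_sum_range' (natDegree_lt_iff_degree_lt hp |>.2 hn)]
  calc ‖∑ i ∈ Finset.range n, p.coeff i * x ^ i‖
      ≤ ∑ i ∈ Finset.range n, ‖p.coeff i * x ^ i‖ := norm_sum_le _ _
    _ ≤ ∑ i ∈ Finset.range n, M * R ^ i := by
        refine Finset.sum_le_sum fun i _ => ?_
        rw [norm_mul, norm_pow]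
        gcongr
        exact hM i
    _ = M * ∑ i ∈ Finset.range n, R ^ i := by rw [Finset.mul_sum]
    _ ≤ M * R ^ n := by
        gcongr
        linarith [sum_range_pow_le_pow hR n]

theorem norm_pow_sub_pow_le {x y : 𝕜} {R : ℝ} (hx : ‖x‖ ≤ R) (hy : ‖y‖ ≤ R) (n : ℕ) :
    ‖x ^ n - y ^ n‖ ≤ n * R ^ (n - 1) * ‖x - y‖ := by
  have hR : 0 ≤ R := (norm_nonneg _).trans hx
  rw [← (Commute.all x y).geom_sum₂_mul, norm_mul]
  gcongr
  refine (norm_sum_le _ _).trans ?_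
  calc ∑ i ∈ Finset.range n, ‖x ^ i * y ^ (n - 1 - i)‖
      ≤ ∑ i ∈ Finset.range n, R ^ (n - 1) := by
        refine Finset.sum_le_sum fun i hi => ?_
        have hi := Finset.mem_range.1 hi
        rw [norm_mul, norm_pow, norm_pow]
        calc ‖x‖ ^ i * ‖y‖ ^ (n - 1 - i) ≤ R ^ i * R ^ (n - 1 - i) := by gcongr
          _ = R ^ (n - 1) := by rw [← pow_add]; congr 1; omega
    _ = n * R ^ (n - 1) := by simp

/-- Each monomial is Lipschitz on the disc of radius `R`, and the constants sum geometrically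
because `R ≥ 2`. The field is general because the bound serves both real points below `q` and
complex roots near `q`. -/
theorem norm_eval_sub_eval_le {p : 𝕜[X]} {n : ℕ} (hn : p.degree < n) {M R : ℝ}
    (hM : ∀ j, ‖p.coeff j‖ ≤ M) (hR : 2 ≤ R) {x y : 𝕜} (hx : ‖x‖ ≤ R) (hy : ‖y‖ ≤ R) :
    ‖p.eval x - p.eval y‖ ≤ M * n * R ^ (n - 1) * ‖x - y‖ := by
  have hM0 : 0 ≤ M := (norm_nonneg _).trans (hM 0)
  by_cases hp : p = 0
  · simp only [hp, eval_zero, sub_zero, norm_zero]; positivity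
  have hlt := natDegree_lt_iff_degree_lt hp |>.2 hn
  rw [eval_eq_sum_range' hlt, eval_eq_sum_range' hlt, ← Finset.sum_sub_distrib]
  obtain ⟨m, rfl⟩ : ∃ m, n = m + 1 := ⟨n - 1, by omega⟩
  calc ‖∑ i ∈ Finset.range (m + 1), (p.coeff i * x ^ i - p.coeff i * y ^ i)‖
      ≤ ∑ i ∈ Finset.range (m + 1), ‖p.coeff i * x ^ i - p.coeff i * y ^ i‖ := norm_sum_le _ _
    _ ≤ ∑ i ∈ Finset.range (m + 1), M * ((i : ℝ) * R ^ (i - 1) * ‖x - y‖) := by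
        refine Finset.sum_le_sum fun i _ => ?_
        rw [← mul_sub, norm_mul]
        gcongr
        · exact hM i
        · exact norm_pow_sub_pow_le hx hy i
    _ = M * (∑ i ∈ Finset.range m, ((i + 1 : ℕ) : ℝ) * R ^ i) * ‖x - y‖ := by
        rw [← Finset.mul_sum, Finset.sum_range_succ', ← Finset.sum_mul]
        simp [mul_assoc]
    _ ≤ M * (∑ i ∈ Finset.range m, ((m + 1 : ℕ) : ℝ) * R ^ i) * ‖x - y‖ := by
        gcongr with i hi
        exact (Finset.mem_range.1 hi).le
    _ ≤ M * (m + 1 : ℕ) * R ^ (m + 1 - 1) * ‖x - y‖ := by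
        rw [← Finset.mul_sum, ← mul_assoc M, Nat.add_sub_cancel]
        gcongr
        linarith [sum_range_pow_le_pow hR m]

end

theorem norm_coeff_derivative_le {K : Type*} [NormedField K] [NormedAlgebra ℝ K] {p : K[X]}
    {n : ℕ} (hn : p.degree < n) {M : ℝ} (hM : ∀ j, ‖p.coeff j‖ ≤ M) (j : ℕ) :
    ‖p.derivative.coeff j‖ ≤ n * M := by
  have hM0 : 0 ≤ M := (norm_nonneg _).trans (hM 0)
  rw [coeff_derivative, norm_mul]
  by_cases hj : j + 1 < n
  · have h1 : ‖((j : K) + 1)‖ ≤ n := by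
      have : ‖((j + 1 : ℕ) : K)‖ = (j + 1 : ℕ) := by
        rw [← map_natCast (algebraMap ℝ K), norm_algebraMap']
        simp only [RCLike.norm_natCast]
      push_cast at this
      rw [this]
      exact_mod_cast hj.le
    rw [mul_comm]
    gcongr
    exact hM _
  · rw [coeff_eq_zero_of_degree_lt (hn.trans_le (by exact_mod_cast not_lt.1 hj))]
    simp only [norm_zero, zero_mul]
    positivity

/-! ### Autocorrelation bits, periods, and the gap between two correlation polynomials. -/

section
variable {q : ℕ}

theorem corrBit_le_one (w : List (Fin q)) (i : ℕ) : corrBit w i ≤ 1 := by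
  unfold corrBit; split_ifs <;> simp

/-- An overlap of length `i` is the same thing as a period `w.length - i`; this is the form in which
overlaps are combined. -/
theorem corrBit_eq_one_iff {w : List (Fin q)} {i : ℕ} (hi : i ≤ w.length) :
    corrBit w i = 1 ↔ ∀ t, t < i → w[t]? = w[t + (w.length - i)]? := by
  have h : corrBit w i = 1 ↔ w.take i = w.drop (w.length - i) := by
    unfold corrBit; split_ifs with h <;> simp [h]
  rw [h, List.ext_getElem?_iff]
  refine forall_congr' fun t => ?_
  rw [List.getElem?_take, List.getElem?_drop, add_comm t]
  split_ifs with ht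
  · simp [ht]
  · simp only [ht, false_imp_iff, iff_true]
    exact (List.getElem?_eq_none (by omega)).symm

theorem corrBit_length (w : List (Fin q)) : corrBit w w.length = 1 := by
  simp [corrBit]

/-- A word with two consecutive periods `a` and `a + 1` with `2 * a < w.length` is constant, so
all its autocorrelation bits are `1`. -/
theorem corrBit_eq_one_of_consecutive {w : List (Fin q)} {a : ℕ} (ha : 2 * a + 1 ≤ w.length)
    (h1 : corrBit w (w.length - a) = 1) (h2 : corrBit w (w.length - (a + 1)) = 1)
    {i : ℕ} (hi : i ≤ w.length) : corrBit w i = 1 := by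
  rw [corrBit_eq_one_iff (Nat.sub_le _ _), Nat.sub_sub_self (by omega)] at h1 h2
  have hstep : ∀ t, t + 1 < w.length → w[t + 1]? = w[t]? := by
    intro t ht
    -- Neighbouring letters are linked through position `t + a + 1` when it exists, and otherwise
    -- through `t - a`, which exists because `2 * a + 1 ≤ w.length`.
    by_cases hta : t + a + 1 < w.length
    · rw [h2 t (by omega), h1 (t + 1) (by omega)]
      congr 1; omega
    · have e1 := h2 (t - a) (by omega)
      have e2 := h1 (t - a) (by omega)
      rw [show t - a + (a + 1) = t + 1 by omega] at e1
      rw [show t - a + a = t by omega] at e2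
      rw [← e1, e2]
  have hconst : ∀ t, t < w.length → w[t]? = w[0]? := by
    intro t
    induction t with
    | zero => intro _; rfl
    | succ t ih => intro ht; rw [hstep t ht, ih (by omega)]
  rw [corrBit_eq_one_iff hi]
  intro t ht
  rw [hconst t (by omega), hconst (t + (w.length - i)) (by omega)]

theorem sum_Icc_one_eq_sum_range {M : Type*} [AddCommMonoid M] (f : ℕ → M) (n : ℕ) :
    ∑ i ∈ Finset.Icc 1 n, f i = ∑ j ∈ Finset.range n, f (j + 1) := by
  rw [Finset.range_eq_Ico, Finset.sum_Ico_add' f 0 n 1]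
  rfl

theorem corrPoly_eq_sum_range (w : List (Fin q)) :
    corrPoly w = ∑ j ∈ Finset.range w.length, C (corrBit w (j + 1) : ℝ) * X ^ j := by
  rw [corrPoly, sum_Icc_one_eq_sum_range]
  simp

theorem corrValue_eq_sum_range (w : List (Fin q)) :
    corrValue w = ∑ j ∈ Finset.range w.length, corrBit w (j + 1) * 2 ^ j := by
  rw [corrValue, sum_Icc_one_eq_sum_range]
  simp

theorem coeff_corrPoly (w : List (Fin q)) (j : ℕ) :
    (corrPoly w).coeff j = if j < w.length then (corrBit w (j + 1) : ℝ) else 0 := by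
  rw [corrPoly_eq_sum_range, finsetSum_coeff]
  simp [coeff_X_pow]

theorem degree_corrPoly_lt (w : List (Fin q)) : (corrPoly w).degree < w.length := by
  rw [degree_lt_iff_coeff_zero]
  intro j hj
  rw [coeff_corrPoly, if_neg (by omega)]

theorem coeff_corrPoly_nonneg (w : List (Fin q)) (j : ℕ) : 0 ≤ (corrPoly w).coeff j := by
  rw [coeff_corrPoly]; split_ifs <;> simp

theorem coeff_corrPoly_le_one (w : List (Fin q)) (j : ℕ) : (corrPoly w).coeff j ≤ 1 := by
  rw [coeff_corrPoly]; split_ifs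
  · exact_mod_cast corrBit_le_one _ _
  · simp

theorem norm_coeff_corrPoly_le (w : List (Fin q)) (j : ℕ) : ‖(corrPoly w).coeff j‖ ≤ 1 := by
  rw [Real.norm_of_nonneg (coeff_corrPoly_nonneg w j)]
  exact coeff_corrPoly_le_one w j

theorem eval_corrPoly (w : List (Fin q)) (x : ℝ) :
    (corrPoly w).eval x = ∑ j ∈ Finset.range w.length, (corrBit w (j + 1) : ℝ) * x ^ j := by
  rw [corrPoly_eq_sum_range, eval_finsetSum]
  simp

theorem pow_le_eval_corrPoly {w : List (Fin q)} (hw : 1 ≤ w.length) {x : ℝ} (hx : 0 ≤ x) :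
    x ^ (w.length - 1) ≤ (corrPoly w).eval x := by
  rw [eval_corrPoly]
  have h := Finset.single_le_sum (f := fun j => (corrBit w (j + 1) : ℝ) * x ^ j)
    (s := Finset.range w.length) (fun j _ => by positivity)
    (Finset.mem_range.2 (by omega : w.length - 1 < w.length))
  simpa [Nat.sub_add_cancel hw, corrBit_length] using h

theorem eval_derivative_corrPoly_nonneg (w : List (Fin q)) {x : ℝ} (hx : 0 ≤ x) :
    0 ≤ (corrPoly w).derivative.eval x := by
  rw [eval_eq_sum_range]
  refine Finset.sum_nonneg fun j _ => mul_nonneg ?_ (by positivity)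
  rw [coeff_derivative]
  exact mul_nonneg (coeff_corrPoly_nonneg _ _) (by positivity)

/-- Two binary expansions in increasing order have a highest digit at which they differ. -/
theorem exists_top_digit_of_sum_lt {u v : ℕ → ℕ} (hu : ∀ j, u j ≤ 1) (hv : ∀ j, v j ≤ 1) {n : ℕ}
    (h : ∑ j ∈ Finset.range n, v j * 2 ^ j < ∑ j ∈ Finset.range n, u j * 2 ^ j) :
    ∃ m < n, u m = 1 ∧ v m = 0 ∧ ∀ j, m < j → j < n → u j = v j := by
  induction n with
  | zero => simp at h
  | succ n ih =>
    rw [Finset.sum_range_succ, Finset.sum_range_succ] at h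
    have hlt : ∑ j ∈ Finset.range n, u j * 2 ^ j < 2 ^ n := by
      refine lt_of_le_of_lt (Finset.sum_le_sum fun j _ => Nat.mul_le_mul_right _ (hu j)) ?_
      simp only [one_mul]
      rw [Nat.geomSum_eq le_rfl]
      have := Nat.one_le_two_pow (n := n)
      simp
    rcases Nat.lt_trichotomy (u n) (v n) with hlt' | heq | hgt
    · have h0 : u n = 0 := by have := hv n; omega
      have h1 : v n = 1 := by have := hv n; omega
      rw [h0, h1] at h
      omega
    · rw [heq] at h
      obtain ⟨m, hm, h1, h2, h3⟩ := ih (by omega)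
      refine ⟨m, by omega, h1, h2, fun j hj hjn => ?_⟩
      rcases Nat.lt_succ_iff_lt_or_eq.1 hjn with hj' | rfl
      · exact h3 j hj hj'
      · exact heq
    · refine ⟨n, by omega, by have := hu n; omega, by have := hu n; omega, fun j _ _ => by omega⟩

/-- The highest degree at which two correlation polynomials differ, and a lower bound for the
resulting gap of their values at `q`. -/
theorem exists_corrPoly_gap {w w' : List (Fin q)} (hq : 2 ≤ q) {k : ℕ} (hk : w.length = k)
    (hk' : w'.length = k) (h : corrValue w' < corrValue w) :
    ∃ m < k, (corrPoly w - corrPoly w').degree < (m + 1 : ℕ) ∧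
      1 ≤ (corrPoly w).eval (q : ℝ) - (corrPoly w').eval (q : ℝ) ∧
      (q : ℝ) ^ m ≤ 4 * (q : ℝ) ^ (k / 2) *
        ((corrPoly w).eval (q : ℝ) - (corrPoly w').eval (q : ℝ)) := by
  rw [corrValue_eq_sum_range, corrValue_eq_sum_range, hk, hk'] at h
  obtain ⟨m, hm, hum, hvm, htop⟩ := exists_top_digit_of_sum_lt
    (fun j => corrBit_le_one w (j + 1)) (fun j => corrBit_le_one w' (j + 1)) h
  have hq' : (2 : ℝ) ≤ q := by exact_mod_cast hq
  obtain ⟨v, hv⟩ : ∃ v : ℕ → ℝ, ∀ j, v j = (corrBit w' (j + 1) : ℝ) := ⟨_, fun _ => rfl⟩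
  have hv0 : ∀ j, 0 ≤ v j := fun j => by rw [hv]; positivity
  have hv1 : ∀ j, v j ≤ 1 := fun j => by rw [hv]; exact_mod_cast corrBit_le_one _ _
  have hΔ : (q : ℝ) ^ m - ∑ j ∈ Finset.range m, v j * (q : ℝ) ^ j ≤
      (corrPoly w).eval (q : ℝ) - (corrPoly w').eval (q : ℝ) := by
    rw [eval_corrPoly, eval_corrPoly, hk, hk', ← Finset.sum_sub_distrib,
      ← Finset.sum_range_add_sum_Ico _ (by omega : m + 1 ≤ k), Finset.sum_range_succ, hum, hvm]
    rw [Finset.sum_eq_zero (s := Finset.Ico (m + 1) k)]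
    · have : -∑ j ∈ Finset.range m, v j * (q : ℝ) ^ j ≤ ∑ j ∈ Finset.range m,
          ((corrBit w (j + 1) : ℝ) * (q : ℝ) ^ j - (corrBit w' (j + 1) : ℝ) * (q : ℝ) ^ j) := by
        rw [← Finset.sum_neg_distrib]
        refine Finset.sum_le_sum fun j _ => ?_
        rw [hv]
        have : (0 : ℝ) ≤ (corrBit w (j + 1) : ℝ) * (q : ℝ) ^ j := by positivity
        linarith
      push_cast
      linarith
    · intro j hj
      have hj := Finset.mem_Ico.1 hj
      rw [htop j (by omega) (by omega), sub_self]
  have hsum : ∀ n, ∑ j ∈ Finset.range n, v j * (q : ℝ) ^ j ≤ (q : ℝ) ^ n - 1 := fun n => by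
    refine le_trans (Finset.sum_le_sum fun j _ => ?_) (sum_range_pow_le_pow hq' n)
    exact mul_le_of_le_one_left (by positivity) (hv1 j)
  have hΔ1 : 1 ≤ (corrPoly w).eval (q : ℝ) - (corrPoly w').eval (q : ℝ) := by
    linarith [hsum m]
  refine ⟨m, hm, ?_, hΔ1, ?_⟩
  · rw [degree_lt_iff_coeff_zero]
    intro j hj
    rw [coeff_sub, coeff_corrPoly, coeff_corrPoly, hk, hk']
    split_ifs with hjk
    · rw [htop j (by omega) hjk, sub_self]
    · simp
  -- For small `m` the trivial bound of the gap below by `1` suffices; the factor `q ^ (k / 2)` is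
  -- the price of this case.
  · by_cases hmk : m ≤ k / 2
    · calc (q : ℝ) ^ m ≤ (q : ℝ) ^ (k / 2) := pow_le_pow_right₀ (by linarith) hmk
        _ ≤ 4 * (q : ℝ) ^ (k / 2) *
          ((corrPoly w).eval (q : ℝ) - (corrPoly w').eval (q : ℝ)) := by
          nlinarith [pow_pos (by linarith : (0 : ℝ) < q) (k / 2)]
    · have hΔ4 : (q : ℝ) ^ m ≤
          4 * ((corrPoly w).eval (q : ℝ) - (corrPoly w').eval (q : ℝ)) := by
        obtain ⟨n, rfl⟩ : ∃ n, m = n + 2 := ⟨m - 2, by omega⟩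
        have hpn : (0 : ℝ) < (q : ℝ) ^ n := by positivity
        -- Two ones just below the top differing digit would give `w'` the consecutive periods `k -
        -- n - 2` and `k - n - 1`, hence make it constant, contradicting its zero digit at `m`.
        have h01 : v (n + 1) = 0 ∨ v n = 0 := by
          by_contra! hne
          have e : ∀ j, v j ≠ 0 → corrBit w' (j + 1) = 1 := fun j hj => by
            rw [hv] at hj
            have : corrBit w' (j + 1) ≠ 0 := by exact_mod_cast hj
            have := corrBit_le_one w' (j + 1)
            omega
          have := corrBit_eq_one_of_consecutive (w := w') (a := k - n - 2) (by omega)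
            (by rw [show w'.length - (k - n - 2) = n + 1 + 1 by omega]; exact e _ hne.1)
            (by rw [show w'.length - (k - n - 2 + 1) = n + 1 by omega]; exact e _ hne.2)
            (i := n + 2 + 1) (by omega)
          omega
        rw [Finset.sum_range_succ, Finset.sum_range_succ] at hΔ
        have hs := hsum n
        rw [pow_succ, pow_succ] at *
        have hp1 := mul_nonneg (mul_nonneg hpn.le (by linarith : (0 : ℝ) ≤ q)) (sub_nonneg.2 hq')
        have hp2 := mul_nonneg hpn.le (sub_nonneg.2 hq')
        -- The second case is the worse one: at `q = 2` it leaves only $q^m-q^{m-1}-q^{m-2}=q^m/4$,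
        -- the source of the factor `4`.
        rcases h01 with h0 | h0
        · rw [h0] at hΔ
          have : v n * (q : ℝ) ^ n ≤ (q : ℝ) ^ n := mul_le_of_le_one_left hpn.le (hv1 n)
          nlinarith
        · rw [h0] at hΔ
          have : v (n + 1) * ((q : ℝ) ^ n * q) ≤ (q : ℝ) ^ n * q :=
            mul_le_of_le_one_left (by positivity) (hv1 _)
          nlinarith
      refine hΔ4.trans ?_
      have : (1 : ℝ) ≤ (q : ℝ) ^ (k / 2) := one_le_pow₀ (by linarith)
      nlinarith
end

/-! ### Partial fractions over the complex numbers. -/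

/-- Reindexing between powers of `X - C a` in a numerator and pole orders: the power `j` over `(X -
C a) ^ n` is a pole of order `n - j`. -/
theorem sum_Icc_partialFraction_eq (n : ℕ) (r : Fin n → ℂ) (f : ℕ → ℂ) :
    ∑ j ∈ Finset.Icc 1 n, (if h : n - j < n then r ⟨n - j, h⟩ else 0) / f j =
      ∑ j : Fin n, r j / f (n - j) := by
  refine Finset.sum_bij' (fun j hj => ⟨n - j, ?_⟩) (fun j _ => n - j) ?_ ?_ ?_ ?_ ?_
  · have := Finset.mem_Icc.1 hj; omega
  · intros; exact Finset.mem_univ _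
  · intro j _; have := j.2; exact Finset.mem_Icc.2 ⟨by omega, by omega⟩
  · intro j hj; have := Finset.mem_Icc.1 hj; simp; omega
  · intro j _; ext; have := j.2; simp; omega
  · intro j hj
    have h := Finset.mem_Icc.1 hj
    have h1 : n - j < n := by omega
    have h2 : n - (n - j) = j := by omega
    simp only [h1, dif_pos, h2]

/-- Every monic complex polynomial of positive degree has a partial fraction decomposition. -/
theorem exists_isPartialFractionDecomp {P : ℂ[X]} (hP : P.Monic) (hdeg : 0 < P.natDegree) :
    ∃ c, IsPartialFractionDecomp P c := by
  classical
  obtain ⟨s, hs⟩ : ∃ s, s = P.roots.toFinset := ⟨_, rfl⟩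
  have hfac : P = ∏ a ∈ s, (X - C a) ^ P.rootMultiplicity a := by
    have h := (IsAlgClosed.splits P).eq_prod_roots_of_monic hP
    conv_lhs => rw [h]
    rw [Finset.prod_multiset_map_count, hs]
    simp [count_roots]
  obtain ⟨u, r, hr, h1⟩ := eq_quo_mul_prod_pow_add_sum_rem_mul_prod_pow (s := s) (1 : ℂ[X])
    (g := fun a : ℂ => X - C a) (fun a _ => monic_X_sub_C a)
    (fun a _ b _ hab => isCoprime_X_sub_C_of_isUnit_sub (sub_ne_zero.2 hab).isUnit)
    (fun a => P.rootMultiplicity a)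
  rw [← hfac] at h1
  have hr' : ∀ a ∈ s, ∀ j, r a j = C ((r a j).coeff 0) := fun a ha j =>
    eq_C_of_degree_le_zero (by
      have := hr a ha j
      rw [degree_X_sub_C] at this
      exact Nat.WithBot.lt_one_iff_le_zero.1 this)
  have hmul : ∀ a ∈ s, P = (X - C a) ^ P.rootMultiplicity a *
      ∏ b ∈ s.erase a, (X - C b) ^ P.rootMultiplicity b := fun a ha => by
    conv_lhs => rw [hfac]
    exact (Finset.mul_prod_erase _ _ ha).symm
  have hmon : ∀ t : Finset ℂ, (∏ b ∈ t, (X - C b) ^ P.rootMultiplicity b).Monic := fun t =>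
    monic_prod_of_monic _ _ fun b _ => (monic_X_sub_C b).pow _
  -- The polynomial part vanishes by degree: `1` and every remainder term have degree below that of
  -- `P`, so `u * P` does too.
  have hu : u = 0 := by
    by_contra hu
    have hlt : (u * P).degree < P.degree := by
      rw [eq_sub_of_add_eq h1.symm]
      have hPpos : (1 : ℂ[X]).degree < P.degree := by
        rw [degree_one]; exact natDegree_pos_iff_degree_pos.1 hdeg
      refine (degree_sub_le _ _).trans_lt (max_lt hPpos ?_)
      refine (degree_sum_le _ _).trans_lt ((Finset.sup_lt_iff ?_).2 fun a ha => ?_)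
      · exact bot_lt_iff_ne_bot.2 (degree_ne_bot.2 hP.ne_zero)
      refine (degree_sum_le _ _).trans_lt ((Finset.sup_lt_iff ?_).2 fun j _ => ?_)
      · exact bot_lt_iff_ne_bot.2 (degree_ne_bot.2 hP.ne_zero)
      conv_rhs => rw [hmul a ha]
      rw [hr' a ha j, degree_mul, degree_mul, degree_mul, degree_pow, degree_pow, degree_X_sub_C,
        degree_eq_natDegree (hmon _).ne_zero]
      have hj : ((j : ℕ) : WithBot ℕ) < P.rootMultiplicity a := by exact_mod_cast j.2
      refine lt_of_le_of_lt (b := ((j : ℕ) : WithBot ℕ) +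
        ((∏ b ∈ s.erase a, (X - C b) ^ P.rootMultiplicity b).natDegree : WithBot ℕ)) ?_ ?_
      · gcongr
        refine (add_le_add_left degree_C_le _).trans ?_
        simp
      · simp only [nsmul_eq_mul, mul_one]
        have := j.2
        exact_mod_cast Nat.add_lt_add_right this
          (∏ b ∈ s.erase a, (X - C b) ^ P.rootMultiplicity b).natDegree
    rw [degree_mul] at hlt
    have h0 : 0 ≤ u.degree := zero_le_degree_iff.2 hu
    exact absurd (le_add_of_nonneg_left h0) (not_le.2 hlt)
  rw [hu, zero_mul, zero_add] at h1
  refine ⟨fun a j => if h : P.rootMultiplicity a - j < P.rootMultiplicity a then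
    (r a ⟨_, h⟩).coeff 0 else 0, fun x hx => ?_⟩
  have hPx : P.eval x ≠ 0 := hx
  rw [div_eq_iff hPx, ← hs, Finset.sum_mul]
  have h2 := congrArg (eval x) h1
  rw [eval_one, eval_finsetSum] at h2
  refine h2.trans (Finset.sum_congr rfl fun a ha => ?_)
  rw [sum_Icc_partialFraction_eq _ (fun j => (r a j).coeff 0) fun j => (x - a) ^ j,
    Finset.sum_mul, eval_finsetSum]
  refine Finset.sum_congr rfl fun j _ => ?_
  have hxa : x - a ≠ 0 := fun h => by
    have hroot : a ∈ P.roots := by rwa [hs, Multiset.mem_toFinset] at ha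
    rw [sub_eq_zero.1 h] at hx
    exact hx (isRoot_of_mem_roots hroot)
  rw [congrArg (eval x) (hmul a ha), hr' a ha j]
  simp only [eval_mul, eval_C, eval_pow, eval_sub, eval_X, coeff_C_zero]
  rw [div_mul_eq_mul_div, eq_div_iff (pow_ne_zero _ hxa)]
  have : (x - a) ^ P.rootMultiplicity a =
      (x - a) ^ (P.rootMultiplicity a - (j : ℕ)) * (x - a) ^ (j : ℕ) := by
    rw [← pow_add, Nat.sub_add_cancel j.2.le]
  rw [this]
  ring

/-- At a simple root `a` of `P`, the coefficient of `1 / (x - a)` is `1 / P'(a)`. -/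
theorem IsPartialFractionDecomp.coeff_eq {P : ℂ[X]} {c : ℂ → ℕ → ℂ}
    (h : IsPartialFractionDecomp P c) {a : ℂ} (ha : P.IsRoot a) (hd : P.derivative.eval a ≠ 0) :
    c a 1 = 1 / P.derivative.eval a := by
  classical
  have hP0 : P ≠ 0 := by rintro rfl; simp at hd
  have hmem : a ∈ P.roots.toFinset := by simp [hP0, ha.eq_zero]
  have hmult : P.rootMultiplicity a = 1 := by
    have h1 : 0 < P.rootMultiplicity a := (rootMultiplicity_pos hP0).2 ha
    have h2 : ¬ 1 < P.rootMultiplicity a := fun h2 =>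
      hd ((one_lt_rootMultiplicity_iff_isRoot hP0).1 h2).2
    omega
  set T : ℂ → ℂ := fun x => ∑ b ∈ P.roots.toFinset.erase a,
    ∑ j ∈ Finset.Icc 1 (P.rootMultiplicity b), c b j / (x - b) ^ j
  have hT : ContinuousAt T a := by
    refine tendsto_finsetSum _ fun b hb => tendsto_finsetSum _ fun j _ => ?_
    have hab : a - b ≠ 0 := sub_ne_zero.2 (Finset.ne_of_mem_erase hb).symm
    exact ContinuousAt.div (by fun_prop) (by fun_prop) (pow_ne_zero _ hab)
  have hnr : ∀ᶠ x in nhdsWithin a {a}ᶜ, ¬ P.IsRoot x := by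
    have hfin : {x | P.IsRoot x}.Finite := (Finset.finite_toSet P.roots.toFinset).subset
      fun x hx => by simpa [hP0] using hx
    have := (hfin.subset (Set.sdiff_subset (t := {a}))).isClosed.isOpen_compl.mem_nhds
      (x := a) (by simp)
    filter_upwards [nhdsWithin_le_nhds this, self_mem_nhdsWithin] with x hx hxa hr
    exact hx ⟨hr, hxa⟩
  -- Multiply the decomposition by `x - a` and let `x` tend to `a`: one side is an inverse
  -- difference quotient, the other tends to `c a 1`.
  have hlim1 : Filter.Tendsto (fun x => (x - a) / P.eval x) (nhdsWithin a {a}ᶜ)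
      (nhds (P.derivative.eval a)⁻¹) := by
    have h1 := (hasDerivAt_iff_tendsto_slope.1 (P.hasDerivAt a)).inv₀ hd
    refine h1.congr fun x => ?_
    rw [slope_def_field, ha.eq_zero, sub_zero, inv_div]
  have hlim2 : Filter.Tendsto (fun x => c a 1 + (x - a) * T x) (nhdsWithin a {a}ᶜ)
      (nhds (c a 1 + (a - a) * T a)) := by
    refine Filter.Tendsto.mono_left ?_ nhdsWithin_le_nhds
    have : ContinuousAt (fun x => x - a) a := by fun_prop
    exact tendsto_const_nhds.add (this.mul hT)
  rw [sub_self, zero_mul, add_zero] at hlim2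
  rw [one_div]
  refine tendsto_nhds_unique_of_eventuallyEq hlim2 hlim1 ?_
  filter_upwards [hnr, self_mem_nhdsWithin] with x hx hxa
  have hxa' : x - a ≠ 0 := sub_ne_zero.2 hxa
  have := h x hx
  rw [← Finset.add_sum_erase _ _ hmem, hmult, Finset.Icc_self, Finset.sum_singleton, pow_one] at this
  rw [div_eq_mul_one_div, this, mul_add, mul_div_cancel₀ _ hxa']

/-! ### Existence and location of the dominant root. -/

section
variable {q : ℕ}

theorem eval_map_corrPoly (w : List (Fin q)) (z : ℂ) :
    ((corrPoly w).map (algebraMap ℝ ℂ)).eval z =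
      ∑ j ∈ Finset.range w.length, (corrBit w (j + 1) : ℂ) * z ^ j := by
  rw [corrPoly_eq_sum_range, Polynomial.map_sum, eval_finsetSum]
  simp

theorem norm_sum_bit_mul_pow_le {u : ℕ → ℕ} (hu : ∀ j, u j ≤ 1) {z : ℂ} (hz : 1.9 ≤ ‖z‖)
    (n : ℕ) : ‖∑ j ∈ Finset.range n, (u j : ℂ) * z ^ j‖ ≤ ‖z‖ ^ n / 0.9 := by
  induction n with
  | zero => norm_num
  | succ n ih =>
    rw [Finset.sum_range_succ]
    refine (norm_add_le _ _).trans ?_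
    have h1 : ‖(u n : ℂ) * z ^ n‖ ≤ ‖z‖ ^ n := by
      rw [norm_mul, norm_pow, Complex.norm_natCast]
      exact mul_le_of_le_one_left (by positivity) (by exact_mod_cast hu n)
    have h2 : 0 ≤ ‖z‖ ^ n * (‖z‖ - 1.9) := mul_nonneg (by positivity) (by linarith)
    rw [pow_succ]
    norm_num at *
    linarith

/-- Away from the disc of radius `1.9`, a correlation polynomial is comparable to its leading
term. -/
theorem norm_eval_corrPoly_ge {w : List (Fin q)} (hw : 5 ≤ w.length) {z : ℂ} (hz : 1.9 ≤ ‖z‖) :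
    ‖z‖ ^ (w.length - 1) / 4 ≤ ‖((corrPoly w).map (algebraMap ℝ ℂ)).eval z‖ := by
  rw [eval_map_corrPoly]
  obtain ⟨n, hn⟩ : ∃ n, w.length = n + 4 := ⟨w.length - 4, by omega⟩
  obtain ⟨u, hu⟩ : ∃ u : ℕ → ℕ, ∀ j, u j = corrBit w (j + 1) := ⟨_, fun _ => rfl⟩
  have hu1 : ∀ j, u j ≤ 1 := fun j => hu j ▸ corrBit_le_one _ _
  simp_rw [← hu]
  set x := ‖z‖ with hx
  have hxn : 1 ≤ x ^ n := one_le_pow₀ (by norm_num at hz; linarith)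
  have htop : u (n + 3) = 1 := by rw [hu, show n + 3 + 1 = w.length by omega, corrBit_length]
  -- If every bit is `1`, the polynomial is a geometric sum. Otherwise consecutive short periods are
  -- excluded, which forces zeros next to the leading term.
  by_cases hall : ∀ j < w.length, u j = 1
  · have hgeom : (∑ j ∈ Finset.range w.length, (u j : ℂ) * z ^ j) * (z - 1) = z ^ w.length - 1 := by
      rw [← geom_sum_mul]
      congr 1
      refine Finset.sum_congr rfl fun j hj => ?_
      rw [hall j (Finset.mem_range.1 hj)]
      simp
    have h1 := congrArg norm hgeom
    rw [norm_mul] at h1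
    have h2 : ‖z - 1‖ ≤ x + 1 := (norm_sub_le _ _).trans (by simp [hx])
    have h3 : x ^ w.length - 1 ≤ ‖z ^ w.length - 1‖ := by
      refine le_trans ?_ (norm_sub_norm_le _ _)
      simp [hx]
    have h4 : x ^ w.length - 1 ≤
        ‖∑ j ∈ Finset.range w.length, (u j : ℂ) * z ^ j‖ * (x + 1) := by
      rw [← h1] at h3
      exact h3.trans (by gcongr)
    by_contra! hlt
    have h5 : x ^ w.length - 1 < x ^ (w.length - 1) / 4 * (x + 1) :=
      h4.trans_lt (mul_lt_mul_of_pos_right hlt (by positivity))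
    have hpow : x ^ w.length = x ^ (w.length - 1) * x := by rw [← pow_succ]; congr 1; omega
    have hy : 1 ≤ x ^ (w.length - 1) := one_le_pow₀ (by norm_num at hz; linarith)
    rw [hpow] at h5
    norm_num at hz
    nlinarith
  · have hcons : ∀ a, 2 * a + 1 ≤ w.length → u (w.length - a - 1) = 0 ∨
        u (w.length - (a + 1) - 1) = 0 := by
      intro a ha
      by_contra! hne
      refine hall fun j hj => ?_
      rw [hu]
      refine corrBit_eq_one_of_consecutive ha ?_ ?_ (by omega)
      · have h1 := hu1 (w.length - a - 1)
        have h2 := hu (w.length - a - 1)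
        rw [show w.length - a - 1 + 1 = w.length - a by omega] at h2
        omega
      · have h1 := hu1 (w.length - (a + 1) - 1)
        have h2 := hu (w.length - (a + 1) - 1)
        rcases Nat.lt_or_ge (a + 1) w.length with hlt | hge
        · rw [show w.length - (a + 1) - 1 + 1 = w.length - (a + 1) by omega] at h2
          omega
        · omega
    have h0 : u (n + 2) = 0 := by
      rcases hcons 0 (by omega) with h | h
      · rw [show w.length - 0 - 1 = n + 3 by omega] at h; omega
      · rwa [show w.length - (0 + 1) - 1 = n + 2 by omega] at h
    -- Here the excluded periods are `2` and `3`; this is what requires length at least `5`.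
    have h23 : u (n + 1) = 0 ∨ u n = 0 := by
      have := hcons 2 (by omega)
      rwa [show w.length - 2 - 1 = n + 1 by omega, show w.length - (2 + 1) - 1 = n by omega] at this
    have hS := norm_sum_bit_mul_pow_le hu1 hz n
    rw [hn, show n + 4 - 1 = n + 3 by omega, Finset.sum_range_succ, Finset.sum_range_succ,
      Finset.sum_range_succ, Finset.sum_range_succ, htop, h0]
    set S := ∑ j ∈ Finset.range n, (u j : ℂ) * z ^ j
    have key : x ^ (n + 3) ≤ ‖S + (u n : ℂ) * z ^ n + (u (n + 1) : ℂ) * z ^ (n + 1) +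
        ((0 : ℕ) : ℂ) * z ^ (n + 2) + ((1 : ℕ) : ℂ) * z ^ (n + 3)‖ + ‖S‖ + u n * x ^ n +
        u (n + 1) * x ^ (n + 1) := by
      have e : z ^ (n + 3) = (S + (u n : ℂ) * z ^ n + (u (n + 1) : ℂ) * z ^ (n + 1) +
        ((0 : ℕ) : ℂ) * z ^ (n + 2) + ((1 : ℕ) : ℂ) * z ^ (n + 3)) - S - (u n : ℂ) * z ^ n
        - (u (n + 1) : ℂ) * z ^ (n + 1) := by push_cast; ring
      calc x ^ (n + 3) = ‖z ^ (n + 3)‖ := by rw [norm_pow]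
        _ ≤ _ := by
          conv_lhs => rw [e]
          refine (norm_sub_le _ _).trans ?_
          gcongr
          · refine (norm_sub_le _ _).trans ?_
            gcongr
            · exact norm_sub_le _ _
            · simp [hx]
          · simp [hx]
    have e1 : x ^ (n + 1) = x ^ n * x := pow_succ _ _
    have e3 : x ^ (n + 3) = x ^ n * x * x * x := by ring
    rw [e1, e3] at key
    rw [e3]
    have hz' : 0 ≤ x - 1.9 := by linarith
    have hx2 : x ^ n * 1.9 ≤ x ^ n * x := by gcongr
    have hx3 : x ^ n * x * 1.9 ≤ x ^ n * x * x := by gcongr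
    have hx4 : x ^ n * x * x * 1.9 ≤ x ^ n * x * x * x := by gcongr
    have hu' : ∀ j, (u j : ℝ) ≤ 1 := fun j => by exact_mod_cast hu1 j
    rcases h23 with h | h
    · rw [h] at key ⊢
      have : (u n : ℝ) * x ^ n ≤ x ^ n := mul_le_of_le_one_left (by positivity) (hu' n)
      norm_num at *
      linarith
    · rw [h] at key ⊢
      have : (u (n + 1) : ℝ) * (x ^ n * x) ≤ x ^ n * x :=
        mul_le_of_le_one_left (by positivity) (hu' _)
      norm_num at *
      linarith

theorem eval_recPoly (w : List (Fin q)) (x : ℝ) :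
    (recPoly w).eval x = 1 + (x - q) * (corrPoly w).eval x := by
  simp [recPoly]

theorem eval_map_recPoly (w : List (Fin q)) (z : ℂ) :
    ((recPoly w).map (algebraMap ℝ ℂ)).eval z =
      1 + (z - q) * ((corrPoly w).map (algebraMap ℝ ℂ)).eval z := by
  simp [recPoly]

theorem eval_derivative_recPoly (w : List (Fin q)) (x : ℝ) :
    (recPoly w).derivative.eval x =
      (corrPoly w).eval x - (q - x) * (corrPoly w).derivative.eval x := by
  simp [recPoly, derivative_mul]
  ring

theorem monic_corrPoly {w : List (Fin q)} (hw : 1 ≤ w.length) : (corrPoly w).Monic := by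
  refine monic_of_degree_le (w.length - 1) ?_ ?_
  · exact degree_le_of_natDegree_le (Nat.le_sub_one_of_lt (by
      rcases eq_or_ne (corrPoly w) 0 with h | h
      · rw [h, natDegree_zero]; omega
      · exact (natDegree_lt_iff_degree_lt h).2 (degree_corrPoly_lt w)))
  · rw [coeff_corrPoly, if_pos (by omega), Nat.sub_add_cancel hw, corrBit_length]
    simp

theorem monic_recPoly {w : List (Fin q)} (hw : 1 ≤ w.length) :
    (recPoly w).Monic ∧ 0 < (recPoly w).natDegree := by
  have hm := (monic_X_sub_C (q : ℝ)).mul (monic_corrPoly hw)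
  have hdeg : (1 : ℝ[X]).degree < ((X - C (q : ℝ)) * corrPoly w).degree := by
    rw [degree_mul, degree_X_sub_C, degree_one, degree_eq_natDegree (monic_corrPoly hw).ne_zero]
    exact_mod_cast (by omega : 0 < 1 + (corrPoly w).natDegree)
  refine ⟨hm.add_of_right hdeg, ?_⟩
  rw [recPoly, natDegree_add_eq_right_of_degree_lt hdeg]
  rw [degree_one] at hdeg
  exact natDegree_pos_iff_degree_pos.2 hdeg

/-- Bernoulli bounds $(1-t)^n$ below by $1/2$, and $(1+t)^n(1-t)^n\le1$. -/
theorem one_add_pow_le_two {t : ℝ} (ht : 0 ≤ t) {n : ℕ} (hn : n * t ≤ 1 / 2) :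
    (1 + t) ^ n ≤ 2 := by
  rcases Nat.eq_zero_or_pos n with rfl | hpos
  · norm_num
  have h1n : (1 : ℝ) ≤ n := by exact_mod_cast hpos
  have ht1 : t ≤ 1 / 2 := by nlinarith
  have h1 : 1 / 2 ≤ (1 - t) ^ n := by
    have := one_add_mul_le_pow (a := -t) (by linarith) n
    rw [← sub_eq_add_neg] at this
    linarith
  have h2 : (1 + t) ^ n * (1 - t) ^ n ≤ 1 := by
    rw [← mul_pow]
    exact pow_le_one₀ (by nlinarith) (by nlinarith)
  have h3 : 0 < (1 + t) ^ n := by positivity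
  nlinarith

theorem half_pow_le_pow_sub {r : ℝ} {n : ℕ} (hr : 2 ≤ r) (hn : 4 * (n : ℝ) ≤ r ^ n) :
    r ^ n / 2 ≤ (r - 2 / r ^ n) ^ n := by
  have hQ : 0 < r ^ n := by positivity
  have hn0 : (0 : ℝ) ≤ n := by positivity
  have hQ1 : 1 ≤ r ^ n := one_le_pow₀ (by linarith)
  have e : r - 2 / r ^ n = r * (1 + -(2 / (r * r ^ n))) := by field_simp; ring
  have hle : 2 / (r * r ^ n) ≤ 1 := by rw [div_le_one (by positivity)]; nlinarith
  rw [e, mul_pow]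
  have := one_add_mul_le_pow (a := -(2 / (r * r ^ n))) (by linarith) n
  have h2 : n * (2 / (r * r ^ n)) ≤ 1 / 2 := by
    rw [mul_div_assoc', div_le_iff₀ (by positivity)]; nlinarith
  nlinarith

/-- The dominant real root of `P_w`: its location and the size of `A_w` there. -/
theorem exists_isLargestRoot {w : List (Fin q)} (hq : 2 ≤ q) (hw : 5 ≤ w.length)
    (hQ : 64 * (w.length : ℝ) ≤ (q : ℝ) ^ (w.length - 1)) :
    ∃ α : ℝ, IsLargestRoot (recPoly w) α ∧ (q : ℝ) - 2 / (q : ℝ) ^ (w.length - 1) ≤ α ∧ α < q ∧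
      (q - α) * (corrPoly w).eval α = 1 ∧ (q : ℝ) ^ (w.length - 1) / 2 ≤ (corrPoly w).eval α := by
  have hq' : (2 : ℝ) ≤ q := by exact_mod_cast hq
  obtain ⟨n, hn⟩ : ∃ n, w.length = n + 1 := ⟨w.length - 1, by omega⟩
  have hn4 : (4 : ℝ) ≤ n := by exact_mod_cast (by omega : 4 ≤ n)
  have hA := fun {x : ℝ} (hx : 0 ≤ x) => pow_le_eval_corrPoly (w := w) (by omega) hx
  have hlow := fun {z : ℂ} (hz : 1.9 ≤ ‖z‖) => norm_eval_corrPoly_ge (w := w) hw hz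
  have hQp : 0 < (q : ℝ) ^ n := by positivity
  simp only [hn, Nat.add_sub_cancel] at hA hlow hQ ⊢
  push_cast at hQ
  have hhalf := half_pow_le_pow_sub (n := n) hq' (by linarith)
  set Q := (q : ℝ) ^ n with hQdef
  have h2Q : 2 / Q ≤ 0.1 := by rw [div_le_iff₀ hQp]; norm_num; linarith
  have hx0 : 1.9 ≤ (q : ℝ) - 2 / Q := by norm_num at h2Q ⊢; linarith
  have hx0' : 0 ≤ (q : ℝ) - 2 / Q := le_trans (by norm_num) hx0
  -- The polynomial is nonpositive at $q-2/Q$ and equals $1$ at $q$, so it has a root in between.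
  have hP0 : (recPoly w).eval ((q : ℝ) - 2 / Q) ≤ 0 := by
    have h1 := hhalf.trans (hA hx0')
    have h2 : 2 / Q * (Q / 2) ≤ 2 / Q * (corrPoly w).eval ((q : ℝ) - 2 / Q) := by gcongr
    have h3 : 2 / Q * (Q / 2) = 1 := by field_simp
    rw [eval_recPoly]
    linarith
  have hPq : (recPoly w).eval (q : ℝ) = 1 := by rw [eval_recPoly]; simp
  obtain ⟨α, ⟨hα1, hα2⟩, hα⟩ := intermediate_value_Icc
    (sub_le_self (q : ℝ) (by positivity : 0 ≤ 2 / Q)) (recPoly w).continuous.continuousOn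
    (⟨hP0, by linarith⟩ : (0 : ℝ) ∈ Set.Icc _ _)
  simp only at hα
  have hαA : (q - α) * (corrPoly w).eval α = 1 := by
    rw [eval_recPoly] at hα; linarith
  have hα0 : 1.9 ≤ α := hx0.trans hα1
  have hα0' : 0 ≤ α := hx0'.trans hα1
  have hαn : Q / 2 ≤ α ^ n := hhalf.trans (by gcongr)
  have hAα : Q / 2 ≤ (corrPoly w).eval α := hαn.trans (hA hα0')
  refine ⟨α, ⟨hα, fun z hz hne => ?_⟩, hα1, lt_of_le_of_ne hα2 fun h => ?_, hαA, hAα⟩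
  swap
  · rw [h, sub_self, zero_mul] at hαA; exact zero_ne_one hαA
  by_contra! hlt
  have hz19 : 1.9 ≤ ‖z‖ := hα0.trans hlt
  have hz' : ((q : ℂ) - z) * ((corrPoly w).map (algebraMap ℝ ℂ)).eval z = 1 := by
    have := hz.eq_zero
    rw [eval_map_recPoly] at this
    linear_combination -this
  set a := ((corrPoly w).map (algebraMap ℝ ℂ)).eval z with ha
  have haQ : Q / 8 ≤ ‖a‖ := by
    have h1 := hlow hz19
    have h2 : α ^ n ≤ ‖z‖ ^ n := by gcongr
    linarith
  have hdist : ‖(q : ℂ) - z‖ ≤ 8 / Q := by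
    have := congrArg norm hz'
    rw [norm_mul, norm_one] at this
    rw [le_div_iff₀ hQp]
    nlinarith [norm_nonneg ((q : ℂ) - z)]
  have hzR : ‖z‖ ≤ q + 8 / Q := by
    have : ‖z‖ ≤ ‖(q : ℂ)‖ + ‖(q : ℂ) - z‖ := by
      have := norm_sub_le (q : ℂ) ((q : ℂ) - z)
      rwa [sub_sub_cancel] at this
    rw [Complex.norm_natCast] at this
    linarith
  have hR : (q + 8 / Q) ^ n ≤ 2 * Q := by
    have e : (q : ℝ) + 8 / Q = q * (1 + 8 / (q * Q)) := by field_simp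
    rw [e, mul_pow, ← hQdef, mul_comm]
    gcongr
    refine one_add_pow_le_two (by positivity) ?_
    rw [mul_div_assoc', div_le_iff₀ (by positivity)]
    nlinarith
  have hαR : ‖(α : ℂ)‖ ≤ q + 8 / Q := by
    rw [Complex.norm_real, Real.norm_of_nonneg hα0']
    have : 0 ≤ 8 / Q := by positivity
    linarith
  have hdeg : ((corrPoly w).map (algebraMap ℝ ℂ)).degree < (n + 1 : ℕ) := by
    rw [degree_map, ← hn]; exact degree_corrPoly_lt w
  have hlip := norm_eval_sub_eval_le hdeg (M := 1)
    (fun j => by rw [coeff_map, norm_algebraMap']; exact norm_coeff_corrPoly_le w j)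
    (by have : 0 ≤ 8 / Q := by positivity
        linarith) hαR hzR
  have hevα : ((corrPoly w).map (algebraMap ℝ ℂ)).eval (α : ℂ) = ((corrPoly w).eval α : ℝ) := by
    rw [eval_map_algebraMap, ← Complex.coe_algebraMap, aeval_algebraMap_apply]
    simp
  rw [hevα, ← ha, Nat.add_sub_cancel, one_mul] at hlip
  have hαA' : ((q : ℂ) - α) * ((corrPoly w).eval α : ℝ) = 1 := by exact_mod_cast hαA
  -- Subtracting the two root equations turns closeness of values into closeness of roots; the
  -- Lipschitz bound goes the other way, and the two are incompatible unless the roots coincide.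
  have hid : ((α : ℂ) - z) * (a * ((corrPoly w).eval α : ℝ)) = ((corrPoly w).eval α : ℝ) - a := by
    linear_combination ((corrPoly w).eval α : ℝ) * hz' - a * hαA'
  rw [← hid, norm_mul, norm_mul, Complex.norm_real, Real.norm_of_nonneg (by linarith)] at hlip
  have hpos : 0 < ‖(α : ℂ) - z‖ := norm_pos_iff.2 (sub_ne_zero.2 (Ne.symm hne))
  have h1 : ‖(α : ℂ) - z‖ * (Q / 8 * (Q / 2)) ≤ ‖(α : ℂ) - z‖ * (‖a‖ * (corrPoly w).eval α) := by
    gcongr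
  have h2 : ((n + 1 : ℕ) : ℝ) * (q + 8 / Q) ^ n * ‖(α : ℂ) - z‖ ≤
      ((n + 1 : ℕ) : ℝ) * (2 * Q) * ‖(α : ℂ) - z‖ := by gcongr
  push_cast at *
  -- This would give `Q ≤ 32 * (n + 1)`, against `hQ`.
  have h3 : Q / 8 * (Q / 2) ≤ (n + 1) * (2 * Q) := by
    refine le_of_mul_le_mul_left ?_ hpos
    linarith
  nlinarith

theorem IsLargestRoot.unique {P : ℝ[X]} {α β : ℝ} (hα : IsLargestRoot P α)
    (hβ : IsLargestRoot P β) : α = β := by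
  by_contra hne
  have hroot : ∀ {x : ℝ}, P.IsRoot x → (P.map (algebraMap ℝ ℂ)).IsRoot (x : ℂ) := fun h => by
    exact h.map (f := algebraMap ℝ ℂ)
  have h1 := hα.2 β (hroot hβ.1) (by exact_mod_cast Ne.symm hne)
  have h2 := hβ.2 α (hroot hα.1) (by exact_mod_cast hne)
  rw [Complex.norm_real, Real.norm_eq_abs] at h1 h2
  linarith [le_abs_self α, le_abs_self β]

/-- Simplicity of the root makes its coefficient the same in every decomposition; existence of a
decomposition is needed for the converse. -/
theorem isMainExponent_iff {w : List (Fin q)} (hw : 1 ≤ w.length) {α : ℝ}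
    (hα : IsLargestRoot (recPoly w) α) (hd : (recPoly w).derivative.eval α ≠ 0) {x c : ℝ} :
    IsMainExponent w x c ↔ x = α ∧ c = 1 / (recPoly w).derivative.eval α := by
  have hroot : ((recPoly w).map (algebraMap ℝ ℂ)).IsRoot (α : ℂ) := hα.1.map (f := algebraMap ℝ ℂ)
  have hder : ((recPoly w).map (algebraMap ℝ ℂ)).derivative.eval (α : ℂ) =
      ((recPoly w).derivative.eval α : ℝ) := by
    rw [derivative_map, eval_map_algebraMap, ← Complex.coe_algebraMap, aeval_algebraMap_apply]
    simp
  have hd' : ((recPoly w).map (algebraMap ℝ ℂ)).derivative.eval (α : ℂ) ≠ 0 := by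
    rw [hder]; exact_mod_cast hd
  constructor
  · rintro ⟨hx, f, hf, hc⟩
    obtain rfl := hx.unique hα
    refine ⟨rfl, ?_⟩
    rw [hf.coeff_eq hroot hd', hder] at hc
    exact_mod_cast hc.symm
  · rintro ⟨rfl, rfl⟩
    obtain ⟨hm, hdeg⟩ := monic_recPoly hw
    obtain ⟨f, hf⟩ := exists_isPartialFractionDecomp (hm.map (algebraMap ℝ ℂ))
      (by rwa [natDegree_map])
    refine ⟨hα, f, hf, ?_⟩
    rw [hf.coeff_eq hroot hd', hder]
    push_cast
    rfl
end

/-! ### Calculus of relative errors. -/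

/-- `x` approximates `y` with relative error at most `e`. -/
def RelClose (e x y : ℝ) : Prop := |x - y| ≤ e * y

namespace RelClose
variable {e f x y u v : ℝ}

theorem mul (h : RelClose e x y) (h' : RelClose f u v) (hy : 0 < y) (hv : 0 < v) (he : e ≤ 1) :
    RelClose (e + 2 * f) (x * u) (y * v) := by
  have h1 := abs_le.1 (show |x - y| ≤ e * y from h)
  have e1 : x * u - y * v = x * (u - v) + (x - y) * v := by ring
  have hf : 0 ≤ f * v := (abs_nonneg _).trans h'
  have hx : |x| ≤ 2 * y := abs_le.2 ⟨by nlinarith, by nlinarith⟩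
  calc |x * u - y * v| ≤ |x| * |u - v| + |x - y| * v := by
        rw [e1]
        refine (abs_add_le _ _).trans ?_
        rw [abs_mul, abs_mul, abs_of_pos hv]
    _ ≤ 2 * y * (f * v) + e * y * v := by gcongr <;> assumption
    _ = (e + 2 * f) * (y * v) := by ring

theorem inv (h : RelClose e x y) (hy : 0 < y) (he : e ≤ 1 / 2) :
    RelClose (2 * e) x⁻¹ y⁻¹ := by
  have h1 := abs_le.1 (show |x - y| ≤ e * y from h)
  have hx : y / 2 ≤ x := by nlinarith
  have hx0 : 0 < x := by linarith
  have e1 : x⁻¹ - y⁻¹ = -(x - y) * (x⁻¹ * y⁻¹) := by field_simp; ring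
  have hxi : x⁻¹ ≤ 2 * y⁻¹ := by
    rw [← one_div, ← one_div, mul_one_div, div_le_div_iff₀ hx0 hy]; linarith
  have hey : 0 ≤ e * y := (abs_nonneg _).trans h
  calc |x⁻¹ - y⁻¹| = |x - y| * (x⁻¹ * y⁻¹) := by
        rw [e1, abs_mul, abs_neg, abs_of_pos (by positivity : 0 < x⁻¹ * y⁻¹)]
    _ ≤ e * y * (2 * y⁻¹ * y⁻¹) := by gcongr; exact h
    _ = 2 * e * y⁻¹ := by field_simp

theorem trans (h : RelClose e x y) (h' : RelClose f y u) (he : 0 ≤ e) (hf : f ≤ 1) (hu : 0 < u) :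
    RelClose (2 * e + f) x u := by
  have h1 := abs_le.1 (show |y - u| ≤ f * u from h')
  have h2 : y ≤ 2 * u := by nlinarith
  have h3 : |x - u| ≤ |x - y| + |y - u| := abs_sub_le _ _ _
  have h4 : |x - y| ≤ e * y := h
  have h5 : |y - u| ≤ f * u := h'
  unfold RelClose
  nlinarith

theorem pos (h : RelClose e x y) (hy : 0 < y) (he : e ≤ 1 / 2) : 0 < x := by
  have h1 := abs_le.1 (show |x - y| ≤ e * y from h)
  nlinarith

/-- The logarithm is 1-Lipschitz on $[1,\infty)$, and $\ln(1+y)\ge y/2$ for $y\le1$, so the relative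
error at most doubles. -/
theorem log_one_add (h : RelClose e x y) (hx : 0 ≤ x) (hy : 0 < y) (hy1 : y ≤ 1) :
    RelClose (2 * e) (Real.log (1 + x)) (Real.log (1 + y)) := by
  have hd : ∀ {s t : ℝ}, 0 ≤ s → 0 ≤ t → Real.log (1 + s) - Real.log (1 + t) ≤ |s - t| := by
    intro s t hs ht
    rw [← Real.log_div (by linarith) (by linarith)]
    refine (Real.log_le_sub_one_of_pos (by positivity)).trans ?_
    have e1 : (1 + s) / (1 + t) - 1 = (s - t) / (1 + t) := by field_simp; ring
    rw [e1, div_le_iff₀ (by linarith)]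
    nlinarith [le_abs_self (s - t), abs_nonneg (s - t)]
  have hlog : y / 2 ≤ Real.log (1 + y) := by
    have h1 := Real.one_sub_inv_le_log_of_pos (by linarith : 0 < 1 + y)
    have e1 : 1 - (1 + y)⁻¹ = y / (1 + y) := by field_simp; ring
    rw [e1] at h1
    refine le_trans ?_ h1
    gcongr
    linarith
  have habs : |Real.log (1 + x) - Real.log (1 + y)| ≤ |x - y| :=
    abs_le.2 ⟨by have := hd hy.le hx; rw [abs_sub_comm] at this; linarith, hd hx hy.le⟩
  have he : 0 ≤ e := by
    by_contra! hlt
    have := (abs_nonneg _).trans (show |x - y| ≤ e * y from h)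
    nlinarith
  calc |Real.log (1 + x) - Real.log (1 + y)| ≤ e * y := habs.trans h
    _ ≤ 2 * e * Real.log (1 + y) := by nlinarith

end RelClose

theorem relClose_log_one_add {x e : ℝ} (hx : 0 < x) (hxe : x ≤ e) :
    RelClose e (Real.log (1 + x)) x := by
  have h1 := Real.log_le_sub_one_of_pos (by linarith : 0 < 1 + x)
  have h2 := Real.one_sub_inv_le_log_of_pos (by linarith : 0 < 1 + x)
  have e1 : 1 - (1 + x)⁻¹ = x / (1 + x) := by field_simp; ring
  have h3 : x - x * x ≤ x / (1 + x) := by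
    rw [le_div_iff₀ (by linarith)]; nlinarith [mul_pos hx (mul_pos hx hx)]
  rw [e1] at h2
  refine abs_le.2 ⟨?_, ?_⟩ <;> nlinarith

/-! ### Comparison of values at the dominant roots with values at `q`. -/

theorem le_two_div_of_mul_eq_one {δ A Q : ℝ} (hQ : 0 < Q) (hA : Q / 2 ≤ A) (h : δ * A = 1) :
    0 ≤ δ ∧ Q * δ ≤ 2 := by
  have hA0 : 0 < A := by linarith
  have hδ : 0 ≤ δ := by
    by_contra! hlt
    nlinarith
  exact ⟨hδ, by nlinarith⟩

theorem abs_sub_mul_sq_le {q Q α β A B : ℝ} (hQ : 0 < Q) (hA : Q / 2 ≤ A) (hB : Q / 2 ≤ B)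
    (hα : (q - α) * A = 1) (hβ : (q - β) * B = 1) :
    (α - β) * (A * B) = A - B ∧ Q * Q * |α - β| ≤ 4 * |A - B| := by
  have e : (α - β) * (A * B) = A - B := by linear_combination A * hβ - B * hα
  refine ⟨e, ?_⟩
  rw [← e, abs_mul, abs_of_pos (by nlinarith : 0 < A * B)]
  have h : Q * Q / 4 ≤ A * B := by nlinarith
  nlinarith [abs_nonneg (α - β)]

/-- Values at the dominant roots differ like the values at `q`. -/
theorem relClose_value_gap {q Q k ε Δ α β A B Bα : ℝ} (hQ : 0 < Q)
    (hε : 0 < ε) (hε1 : ε ≤ 1 / 1000) (hkε : k ≤ ε * Q) (hΔ : 0 < Δ)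
    (hA : Q / 2 ≤ A) (hB : Q / 2 ≤ B) (hα : (q - α) * A = 1) (hβ : (q - β) * B = 1)
    (h1 : |Δ - (A - Bα)| ≤ ε * Q * Δ * (q - α)) (h2 : |Bα - B| ≤ k * Q * |α - β|) :
    RelClose (12 * ε) (A - B) Δ ∧ Q * Q * |α - β| ≤ 8 * Δ := by
  obtain ⟨hδ, hδ2⟩ := le_two_div_of_mul_eq_one hQ hA hα
  obtain ⟨-, hd⟩ := abs_sub_mul_sq_le hQ hA hB hα hβ
  have h3 : |A - B - Δ| ≤ |Δ - (A - Bα)| + |Bα - B| := by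
    have e : A - B - Δ = -(Δ - (A - Bα)) + (Bα - B) := by ring
    rw [e]
    refine (abs_add_le _ _).trans ?_
    rw [abs_neg]
  have h4 : |A - B| ≤ |A - B - Δ| + Δ := by
    have := abs_add_le (A - B - Δ) Δ
    rwa [sub_add_cancel, abs_of_pos hΔ] at this
  have h5 : ε * Q * Δ * (q - α) ≤ 2 * ε * Δ := by
    have : ε * Δ * (Q * (q - α)) ≤ ε * Δ * 2 := by gcongr
    linarith
  have h6 : k * Q * |α - β| ≤ 4 * ε * |A - B| := by
    have h7 : k * (Q * |α - β|) ≤ ε * Q * (Q * |α - β|) := by gcongr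
    have h8 : ε * (Q * Q * |α - β|) ≤ ε * (4 * |A - B|) := by gcongr
    linarith
  -- The error is bounded by $2\varepsilon\Delta+4\varepsilon|A-B|$, which involves the error
  -- itself; absorbing that small multiple doubles $6\varepsilon$ to $12\varepsilon$.
  have hX : |A - B - Δ| ≤ 12 * ε * Δ := by
    have h9 : 4 * ε * |A - B| ≤ 4 * ε * (|A - B - Δ| + Δ) := by gcongr
    nlinarith [abs_nonneg (A - B - Δ)]
  refine ⟨hX, ?_⟩
  have : 12 * ε * Δ ≤ Δ := by nlinarith
  linarith

/-- The derivatives of the recurrence polynomials at the dominant roots differ like the values of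
the correlation polynomials at `q`. -/
theorem relClose_derivative_gap {q Q k ε Δ α β A B dA dB dBα : ℝ} (hQ : 0 < Q) (hk : 0 ≤ k)
    (hε : 0 < ε) (hε1 : ε ≤ 1 / 1000) (hkε : k ≤ ε * Q) (hΔ : 0 < Δ)
    (hB : Q / 2 ≤ B) (hβ : (q - β) * B = 1)
    (hgap : RelClose (12 * ε) (A - B) Δ) (hd : Q * Q * |α - β| ≤ 8 * Δ)
    (hdA0 : 0 ≤ dA) (hdA : dA ≤ k * Q)
    (h1 : |dA - dBα| ≤ ε * Q * Δ) (h2 : |dBα - dB| ≤ k * k * Q * |α - β|) :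
    RelClose (24 * ε) (A - (q - α) * dA - (B - (q - β) * dB)) Δ := by
  obtain ⟨hδ, hδ2⟩ := le_two_div_of_mul_eq_one hQ hB hβ
  have h3 : |dA - dB| ≤ ε * Q * Δ + k * k * Q * |α - β| :=
    (abs_sub_le _ dBα _).trans (add_le_add h1 h2)
  -- The three summands contribute $12\varepsilon$, $8\varepsilon$ and $4\varepsilon$.
  have e : A - (q - α) * dA - (B - (q - β) * dB) - Δ =
      (A - B - Δ) + ((α - β) * dA + -((q - β) * (dA - dB))) := by ring
  have h4 : |α - β| * dA ≤ 8 * ε * Δ := by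
    have h5 : |α - β| * dA ≤ |α - β| * (ε * Q * Q) := by
      gcongr
      exact hdA.trans (by gcongr)
    have h6 : ε * (Q * Q * |α - β|) ≤ ε * (8 * Δ) := by gcongr
    linarith
  have h7 : (q - β) * |dA - dB| ≤ 4 * ε * Δ := by
    have h8 : (q - β) * |dA - dB| ≤ (q - β) * (ε * Q * Δ + k * k * Q * |α - β|) := by gcongr
    have h9 : Q * (q - β) * (ε * Δ + k * k * |α - β|) ≤ 2 * (ε * Δ + k * k * |α - β|) := by
      gcongr
    have h10 : k * k * |α - β| ≤ (ε * Q) * (ε * Q) * |α - β| := by gcongr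
    have h11 : ε * ε * (Q * Q * |α - β|) ≤ ε * ε * (8 * Δ) := by gcongr
    have h12 : ε * ε * Δ ≤ 1 / 1000 * ε * Δ := by gcongr
    nlinarith
  have h13 : |A - B - Δ| ≤ 12 * ε * Δ := hgap
  unfold RelClose
  rw [e]
  refine (abs_add_le _ _).trans ?_
  have h14 := abs_add_le ((α - β) * dA) (-((q - β) * (dA - dB)))
  rw [abs_neg, abs_mul, abs_mul, abs_of_nonneg hdA0, abs_of_nonneg hδ] at h14
  linarith

theorem relClose_value {q Q k ε b β B dB : ℝ} (hQ : 0 < Q) (hk : 0 ≤ k)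
    (hkε : k ≤ ε * Q) (hε : 0 < ε) (hb : Q ≤ b) (hB : Q / 2 ≤ B) (hβ : (q - β) * B = 1)
    (h1 : |b - B| ≤ k * Q * (q - β)) (hdB0 : 0 ≤ dB) (hdB : dB ≤ k * Q) :
    RelClose (2 * ε) B b ∧ RelClose (4 * ε) (B - (q - β) * dB) b := by
  obtain ⟨hδ, hδ2⟩ := le_two_div_of_mul_eq_one hQ hB hβ
  have h2 : k * Q * (q - β) ≤ 2 * ε * b := by
    have h0 : k ≤ ε * b := hkε.trans (by gcongr)
    have h3 : k * (Q * (q - β)) ≤ ε * b * 2 :=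
      mul_le_mul h0 hδ2 (by positivity) (hk.trans h0)
    linarith
  have h4 : (q - β) * dB ≤ (q - β) * (k * Q) := by gcongr
  have h5 : 0 ≤ (q - β) * dB := by positivity
  have h6 := abs_le.1 h1
  exact ⟨abs_le.2 ⟨by linarith, by linarith⟩, abs_le.2 ⟨by linarith, by linarith⟩⟩

/-- The crossing point of the two dominant exponentials, up to a relative error `O(ε)`. -/
theorem relClose_crossing {q Q ε Δ a b α β A B G H : ℝ} (hq : 2 ≤ q) (hQ : 0 < Q)
    (hε1 : ε ≤ 1 / 1000) (hQε : 1 ≤ ε * Q) (hΔ : 0 < Δ) (hΔb : Δ ≤ b) (ha : Q ≤ a)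
    (hA : Q / 2 ≤ A) (hB : Q / 2 ≤ B) (hα : (q - α) * A = 1) (hβ : (q - β) * B = 1)
    (hgap : RelClose (12 * ε) (A - B) Δ) (hAa : RelClose (2 * ε) A a) (hBb : RelClose (2 * ε) B b)
    (hGH : RelClose (24 * ε) (G - H) Δ) (hH : RelClose (4 * ε) H b) :
    0 < H ∧ H < G ∧ 0 < β ∧ β < α ∧
      RelClose (216 * ε) (Real.log (G / H) / Real.log (α / β))
        (Real.log (1 + Δ / b) / (Δ / b) * (q * a)) := by
  have hε : 0 < ε := by
    by_contra! h
    nlinarith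
  have ha0 : 0 < a := by linarith
  have hb0 : 0 < b := by linarith
  have hH0 : 0 < H := hH.pos hb0 (by linarith)
  have hGH0 : 0 < G - H := hGH.pos hΔ (by linarith)
  have hAB0 : 0 < A - B := hgap.pos hΔ (by linarith)
  obtain ⟨hδ, hδ2⟩ := le_two_div_of_mul_eq_one hQ hB hβ
  have hδε : q - β ≤ ε * q := by
    have h1 : q - β ≤ 2 * ε := by
      by_contra! h
      have : Q * (2 * ε) < Q * (q - β) := by gcongr
      linarith
    nlinarith
  have hβq : RelClose ε β q := abs_le.2 ⟨by linarith, by nlinarith⟩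
  have hβ0 : 0 < β := hβq.pos (by linarith) (by linarith)
  obtain ⟨hd, -⟩ := abs_sub_mul_sq_le hQ hA hB hα hβ
  have hA0 : 0 < A := by linarith
  have hB0 : 0 < B := by linarith
  have hβα : 0 < α - β := pos_of_mul_pos_left (hd ▸ hAB0) (by positivity)
  refine ⟨hH0, by linarith, hβ0, by linarith, ?_⟩
  have hr0 : 0 < Δ / b := by positivity
  have hr1 : Δ / b ≤ 1 := by rw [div_le_one hb0]; exact hΔb
  have hs : RelClose (40 * ε) ((G - H) / H) (Δ / b) := by
    have := hGH.mul (hH.inv hb0 (by linarith)) hΔ (inv_pos.2 hb0) (by linarith)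
    rw [div_eq_mul_inv, div_eq_mul_inv]
    convert! this using 1
    ring
  have hlogs := hs.log_one_add (by positivity) hr0 hr1
  have hGe : G / H = 1 + (G - H) / H := by field_simp; ring
  -- Based on the exact identity `hd` for `α - β`; the errors add as $12+2\cdot4+2\cdot4+2\cdot2$.
  have hy : RelClose (32 * ε) ((α - β) / β) (Δ / (a * b * q)) := by
    have h1 := ((hgap.mul (hAa.inv ha0 (by linarith)) hΔ (inv_pos.2 ha0) (by linarith)).mul
      (hBb.inv hb0 (by linarith)) (by positivity) (inv_pos.2 hb0) (by linarith)).mul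
      (hβq.inv (by linarith) (by linarith)) (by positivity) (inv_pos.2 (by linarith)) (by linarith)
    have e1 : (α - β) / β = (A - B) * A⁻¹ * B⁻¹ * β⁻¹ := by
      rw [← hd]; field_simp
    have e2 : Δ / (a * b * q) = Δ * a⁻¹ * b⁻¹ * q⁻¹ := by
      field_simp
    rw [e1, e2]
    convert! h1 using 1
    ring
  have hy0 : 0 < Δ / (a * b * q) := by positivity
  have hyε : (α - β) / β ≤ ε := by
    have h1 := (abs_le.1 (show |(α - β) / β - Δ / (a * b * q)| ≤ _ from hy)).2
    have h2 : (α - β) / β ≤ 2 * (Δ / (a * b * q)) := by nlinarith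
    refine h2.trans ?_
    rw [mul_div_assoc', div_le_iff₀ (by positivity)]
    have h3 : 1 ≤ ε * a := hQε.trans (by gcongr)
    have h4 : 1 * b ≤ ε * a * b := by gcongr
    have h5 : ε * a * b * 2 ≤ ε * a * b * q := by gcongr
    linarith
  have hlogy := ((relClose_log_one_add (div_pos hβα hβ0) hyε).trans hy hε.le (by linarith) hy0)
  -- The numerator has error $80\varepsilon$ and the inverted denominator $68\varepsilon$, whence
  -- $80+2\cdot68=216$.
  have hfin := hlogs.mul (hlogy.inv hy0 (by linarith)) (Real.log_pos (by linarith)) (inv_pos.2 hy0)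
    (by linarith)
  have hαe : α / β = 1 + (α - β) / β := by field_simp; ring
  rw [hGe, hαe, div_eq_mul_inv]
  convert! hfin using 1
  · ring
  · field_simp

/-! ### Application to words, and the explicit constants. -/

section
variable {q : ℕ}

theorem sub_one_mul_eval_corrPoly_le (w : List (Fin q)) (hw : 1 ≤ w.length) (hq : 2 ≤ q) :
    ((q : ℝ) - 1) * (corrPoly w).eval (q : ℝ) ≤ q * (q : ℝ) ^ (w.length - 1) := by
  have hq' : (2 : ℝ) ≤ q := by exact_mod_cast hq
  have h1 : (corrPoly w).eval (q : ℝ) ≤ ∑ j ∈ Finset.range w.length, (q : ℝ) ^ j := by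
    rw [eval_corrPoly]
    refine Finset.sum_le_sum fun j _ => mul_le_of_le_one_left (by positivity) ?_
    exact_mod_cast corrBit_le_one _ _
  have h2 := geom_sum_mul (q : ℝ) w.length
  have h3 : (q : ℝ) ^ w.length = q * (q : ℝ) ^ (w.length - 1) := by
    rw [← pow_succ']; congr 1; omega
  have h4 : (corrPoly w).eval (q : ℝ) * ((q : ℝ) - 1) ≤
      (∑ j ∈ Finset.range w.length, (q : ℝ) ^ j) * ((q : ℝ) - 1) := by
    gcongr
    linarith
  linarith

/-- With $Q=q^{k-1}$, the larger value is at most $qQ/(q-1)$, as for the all-ones sequence, and the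
smaller is at least its leading term $Q$. -/
theorem relGap_bounds {w w' : List (Fin q)} (hq : 2 ≤ q) (hw : 1 ≤ w.length)
    (hlen : w'.length = w.length)
    (hgap : 1 ≤ (corrPoly w).eval (q : ℝ) - (corrPoly w').eval (q : ℝ)) :
    0 < relGap w w' ∧ relGap w w' * ((q : ℝ) - 1) ≤ 1 := by
  have hq' : (2 : ℝ) ≤ q := by exact_mod_cast hq
  have h1 := sub_one_mul_eval_corrPoly_le w hw hq
  have h2 := pow_le_eval_corrPoly (w := w') (by omega) (Nat.cast_nonneg (α := ℝ) q)
  rw [hlen] at h2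
  have hb : 0 < (corrPoly w').eval (q : ℝ) := lt_of_lt_of_le (by positivity) h2
  refine ⟨div_pos (by linarith) hb, ?_⟩
  rw [relGap, div_mul_eq_mul_div, div_le_one hb]
  nlinarith

/-- The lower bound is the chain $\ln(1+r)/r\ge1/(1+r)\ge(q-1)/q\ge\ln q/q$. -/
theorem ratioConst_bounds {w w' : List (Fin q)} (hq : 2 ≤ q) (h0 : 0 < relGap w w')
    (h1 : relGap w w' * ((q : ℝ) - 1) ≤ 1) :
    Real.log q / q ≤ ratioConst w w' ∧ ratioConst w w' ≤ 1 := by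
  have hq' : (2 : ℝ) ≤ q := by exact_mod_cast hq
  set r := relGap w w' with hr
  have hlog := Real.one_sub_inv_le_log_of_pos (by linarith : 0 < 1 + r)
  have e1 : 1 - (1 + r)⁻¹ = r / (1 + r) := by field_simp; ring
  rw [e1] at hlog
  rw [ratioConst, ← hr]
  constructor
  · rw [le_div_iff₀ h0]
    refine le_trans ?_ hlog
    have hlq := Real.log_le_sub_one_of_pos (by linarith : (0 : ℝ) < q)
    rw [div_mul_eq_mul_div, div_le_div_iff₀ (by linarith) (by linarith)]
    have h2 : Real.log q * (1 + r) ≤ (q - 1) * (1 + r) := by gcongr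
    have h3 : r * (Real.log q * (1 + r)) ≤ r * q := by
      gcongr
      linarith
    linarith
  · rw [div_le_one h0]
    linarith [Real.log_le_sub_one_of_pos (by linarith : 0 < 1 + r)]

theorem mul_rpow_eq_iff {α β G H : ℝ} (hβ : 0 < β) (hβα : β < α) (hG : 0 < G) (hH : 0 < H)
    (t : ℝ) : 1 / G * α ^ t = 1 / H * β ^ t ↔ t = Real.log (G / H) / Real.log (α / β) := by
  have hα : 0 < α := hβ.trans hβα
  have hlog : 0 < Real.log (α / β) := Real.log_pos ((one_lt_div hβ).2 hβα)
  rw [eq_div_iff hlog.ne', ← Real.log_rpow (by positivity), Real.div_rpow hα.le hβ.le]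
  have h1 : 0 < α ^ t := Real.rpow_pos_of_pos hα t
  have h2 : 0 < β ^ t := Real.rpow_pos_of_pos hβ t
  rw [(Real.log_injOn_pos.eq_iff (Set.mem_Ioi.2 (by positivity)) (Set.mem_Ioi.2 (by positivity))),
    div_eq_div_iff h2.ne' hH.ne', one_div_mul_eq_div, one_div_mul_eq_div,
    div_eq_div_iff hG.ne' hH.ne', mul_comm G]

theorem linear_le_two_pow {n : ℕ} (hn : 20 ≤ n) : 4000 * (2 * n + 2) ≤ 2 ^ n := by
  induction n, hn using Nat.le_induction with
  | base => norm_num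
  | succ n hn ih => rw [pow_succ]; omega

theorem mul_pow_half_le {k : ℕ} (hq : 2 ≤ q) (hk : 42 ≤ k) :
    4000 * (k : ℝ) * (q : ℝ) ^ (k / 2) ≤ (q : ℝ) ^ (k - 1) := by
  have h1 := linear_le_two_pow (n := k - 1 - k / 2) (by omega)
  have h2 : 4000 * k ≤ q ^ (k - 1 - k / 2) :=
    (by omega : 4000 * k ≤ 4000 * (2 * (k - 1 - k / 2) + 2)).trans
      (h1.trans (Nat.pow_le_pow_left hq _))
  have h3 : 4000 * k * q ^ (k / 2) ≤ q ^ (k - 1) :=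
    calc 4000 * k * q ^ (k / 2) ≤ q ^ (k - 1 - k / 2) * q ^ (k / 2) := Nat.mul_le_mul_right _ h2
      _ = q ^ (k - 1) := by rw [← pow_add]; congr 1; omega
  exact_mod_cast h3

/-- The exponent on the left is at most $-k/2+1$, so the method gives slightly more than the stated
$-k/3+4$. -/
theorem pow_half_div_le {k : ℕ} (hq : 2 ≤ q) (hk : 1 ≤ k) :
    (q : ℝ) ^ (k / 2) / (q : ℝ) ^ (k - 1) ≤ (q : ℝ) ^ (-(k : ℝ) / 3 + 4) := by
  have hq' : (2 : ℝ) ≤ q := by exact_mod_cast hq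
  rw [← Real.rpow_natCast, ← Real.rpow_natCast, ← Real.rpow_sub (by linarith)]
  refine Real.rpow_le_rpow_of_exponent_le (by linarith) ?_
  have h1 : (2 * (k / 2 : ℕ) : ℝ) ≤ k := by exact_mod_cast (by omega : 2 * (k / 2) ≤ k)
  rw [Nat.cast_sub hk]
  push_cast
  have : (1 : ℝ) ≤ k := by exact_mod_cast hk
  linarith

theorem exists_isMainExponent {w : List (Fin q)} (hq : 2 ≤ q) (hw : 5 ≤ w.length)
    (hQ : 64 * (w.length : ℝ) ≤ (q : ℝ) ^ (w.length - 1)) :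
    ∃ α : ℝ, 0 ≤ α ∧ α < q ∧
      (q - α) * (corrPoly w).eval α = 1 ∧ (q : ℝ) ^ (w.length - 1) / 2 ≤ (corrPoly w).eval α ∧
      (corrPoly w).derivative.eval α ≤ w.length * (q : ℝ) ^ (w.length - 1) ∧
      ∀ x c : ℝ, IsMainExponent w x c ↔ x = α ∧
        c = 1 / ((corrPoly w).eval α - (q - α) * (corrPoly w).derivative.eval α) := by
  have hq' : (2 : ℝ) ≤ q := by exact_mod_cast hq
  obtain ⟨α, hα, hlow, hup, hαA, hA⟩ := exists_isLargestRoot hq hw hQ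
  have hw5 : (5 : ℝ) ≤ w.length := by exact_mod_cast hw
  set Q := (q : ℝ) ^ (w.length - 1)
  have hQp : 0 < Q := by positivity
  have hα0 : 0 ≤ α := by
    have : 2 / Q ≤ 1 := by rw [div_le_one hQp]; linarith
    linarith
  have hdeg : (corrPoly w).derivative.degree < (w.length - 1 : ℕ) := by
    rw [degree_lt_iff_coeff_zero]
    intro j hj
    rw [coeff_derivative, coeff_corrPoly, if_neg (by omega), zero_mul]
  have hd := norm_eval_le hdeg (M := w.length) (fun j => by
    simpa using norm_coeff_derivative_le (degree_corrPoly_lt w) (norm_coeff_corrPoly_le w) j) hq'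
    (by rw [Real.norm_of_nonneg hα0]; exact hup.le)
  have hd' := (le_abs_self _).trans hd
  refine ⟨α, hα0, hup, hαA, hA, hd', fun x c => ?_⟩
  rw [← eval_derivative_recPoly]
  refine isMainExponent_iff (by omega) hα ?_
  rw [eval_derivative_recPoly]
  -- The root is simple: the correction to $A_w(\alpha)\ge Q/2$ in the derivative is at most $2k$,
  -- and $Q\ge64k$.
  obtain ⟨hδ, hδ2⟩ := le_two_div_of_mul_eq_one hQp hA hαA
  have h1 : (q - α) * (corrPoly w).derivative.eval α ≤ (q - α) * (w.length * Q) := by gcongr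
  have h2 : w.length * (Q * (q - α)) ≤ w.length * 2 := by gcongr
  have : 0 < (corrPoly w).eval α - (q - α) * (corrPoly w).derivative.eval α := by linarith
  exact this.ne'

/-- The crossing point of the two dominant exponentials attached to the words `w` and `w'`. -/
theorem relClose_word_crossing {k : ℕ} (hq : 2 ≤ q) (hk : 42 ≤ k) {w w' : List (Fin q)}
    (hw : w.length = k) (hw' : w'.length = k) (hlt : corrValue w' < corrValue w) {Q α β : ℝ}
    (hQ : Q = (q : ℝ) ^ (k - 1))
    (hab : (corrPoly w).eval (q : ℝ) - (corrPoly w').eval (q : ℝ) ≤ (corrPoly w').eval (q : ℝ))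
    (hα0 : 0 ≤ α) (hαq : α < q) (hα : (q - α) * (corrPoly w).eval α = 1)
    (hA : Q / 2 ≤ (corrPoly w).eval α) (hdA : (corrPoly w).derivative.eval α ≤ k * Q)
    (hβ0 : 0 ≤ β) (hβq : β < q) (hβ : (q - β) * (corrPoly w').eval β = 1)
    (hB : Q / 2 ≤ (corrPoly w').eval β) (hdB : (corrPoly w').derivative.eval β ≤ k * Q) :
    0 < (corrPoly w').eval β - (q - β) * (corrPoly w').derivative.eval β ∧
      (corrPoly w').eval β - (q - β) * (corrPoly w').derivative.eval β <
        (corrPoly w).eval α - (q - α) * (corrPoly w).derivative.eval α ∧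
      0 < β ∧ β < α ∧
      RelClose (864 * (k * (q : ℝ) ^ (k / 2) / Q))
        (Real.log (((corrPoly w).eval α - (q - α) * (corrPoly w).derivative.eval α) /
          ((corrPoly w').eval β - (q - β) * (corrPoly w').derivative.eval β)) /
          Real.log (α / β))
        (ratioConst w w' * (q * (corrPoly w).eval (q : ℝ))) := by
  have hq' : (2 : ℝ) ≤ q := by exact_mod_cast hq
  have hq0 : (0 : ℝ) ≤ q := by linarith
  have hk1 : (1 : ℝ) ≤ k := by exact_mod_cast (by omega : 1 ≤ k)
  have hsmall := mul_pow_half_le hq hk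
  have hhalf1 : (1 : ℝ) ≤ (q : ℝ) ^ (k / 2) := one_le_pow₀ (by linarith)
  have hkhalf : (k : ℝ) ≤ k * (q : ℝ) ^ (k / 2) := le_mul_of_one_le_right (by linarith) hhalf1
  have hQp : 0 < Q := by rw [hQ]; positivity
  rw [← hQ] at hsmall
  rw [ratioConst, relGap]
  obtain ⟨m, hm, hdeg, hgap1, hgapm⟩ := exists_corrPoly_gap hq hw hw' hlt
  have ha := pow_le_eval_corrPoly (w := w) (by omega) hq0
  have hb := pow_le_eval_corrPoly (w := w') (by omega) hq0
  have hαR : ‖α‖ ≤ q := by rw [Real.norm_of_nonneg hα0]; exact hαq.le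
  have hβR : ‖β‖ ≤ q := by rw [Real.norm_of_nonneg hβ0]; exact hβq.le
  have hqR : ‖(q : ℝ)‖ ≤ q := (Real.norm_of_nonneg hq0).le
  have hlip : ∀ v : List (Fin q), v.length = k → ∀ s t : ℝ, ‖s‖ ≤ q → ‖t‖ ≤ q →
      |(corrPoly v).eval s - (corrPoly v).eval t| ≤ k * Q * |s - t| := fun v hv s t hs ht => by
    have := norm_eval_sub_eval_le (degree_corrPoly_lt v) (norm_coeff_corrPoly_le v) hq' hs ht
    rwa [one_mul, hv, ← hQ] at this
  have hdlip : |(corrPoly w').derivative.eval α - (corrPoly w').derivative.eval β| ≤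
      k * k * Q * |α - β| := by
    have := norm_eval_sub_eval_le (p := (corrPoly w').derivative) (n := k) (M := k)
      ((degree_derivative_le).trans_lt (hw' ▸ degree_corrPoly_lt w'))
      (fun j => by
        simpa [hw'] using
          norm_coeff_derivative_le (degree_corrPoly_lt w') (norm_coeff_corrPoly_le w') j)
      hq' hαR hβR
    rwa [← hQ] at this
  obtain ⟨D, hD⟩ : ∃ D, D = corrPoly w - corrPoly w' := ⟨_, rfl⟩
  rw [← hD] at hdeg
  have hDcoeff : ∀ j, ‖D.coeff j‖ ≤ 1 := fun j => by
    rw [hD, coeff_sub, Real.norm_eq_abs, abs_le]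
    constructor <;>
      linarith [coeff_corrPoly_nonneg w j, coeff_corrPoly_nonneg w' j, coeff_corrPoly_le_one w j,
        coeff_corrPoly_le_one w' j]
  have hmk : ((m + 1 : ℕ) : ℝ) ≤ k := by exact_mod_cast hm
  have hDlip : |D.eval (q : ℝ) - D.eval α| ≤ k * (q : ℝ) ^ m * (q - α) := by
    have := norm_eval_sub_eval_le hdeg hDcoeff hq' hqR hαR
    rw [one_mul, Nat.add_sub_cancel, Real.norm_of_nonneg (by linarith : 0 ≤ (q : ℝ) - α)] at this
    refine this.trans ?_
    have : 0 ≤ (q : ℝ) - α := by linarith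
    gcongr
  have hDder : |D.derivative.eval α| ≤ k * (q : ℝ) ^ m := by
    have hdd : D.derivative.degree < (m : ℕ) := by
      rw [degree_lt_iff_coeff_zero]
      intro j hj
      rw [coeff_derivative, (degree_lt_iff_coeff_zero _ _).1 hdeg _ (by omega), zero_mul]
    refine norm_eval_le hdd (fun j => ?_) hq' hαR
    exact (norm_coeff_derivative_le hdeg hDcoeff j).trans (by rw [mul_one]; exact hmk)
  rw [hD, eval_sub, eval_sub] at hDlip
  rw [hD, derivative_sub, eval_sub] at hDder
  have ea := hlip w hw q α hqR hαR
  have eb := hlip w' hw' q β hqR hβR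
  have exx := hlip w' hw' α β hαR hβR
  rw [abs_of_pos (by linarith : 0 < (q : ℝ) - α)] at ea
  rw [abs_of_pos (by linarith : 0 < (q : ℝ) - β)] at eb
  have hdA0 := eval_derivative_corrPoly_nonneg w hα0
  have hdB0 := eval_derivative_corrPoly_nonneg w' hβ0
  rw [hw, ← hQ] at ha
  rw [hw', ← hQ] at hb
  set a := (corrPoly w).eval (q : ℝ)
  set b := (corrPoly w').eval (q : ℝ)
  set A := (corrPoly w).eval α
  set B := (corrPoly w').eval β
  set dA := (corrPoly w).derivative.eval α
  set dB := (corrPoly w').derivative.eval β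
  obtain ⟨Δ, hΔ⟩ : ∃ Δ, Δ = a - b := ⟨_, rfl⟩
  rw [← hΔ] at hgap1 hgapm hab ⊢
  have hΔ0 : 0 < Δ := by linarith
  -- Chosen so that the gap bound reads $kq^m\le\varepsilon Q\Delta$; then also $k\le\varepsilon Q$.
  obtain ⟨ε, hε⟩ : ∃ ε, ε = 4 * k * (q : ℝ) ^ (k / 2) / Q := ⟨_, rfl⟩
  have hεQ : ε * Q = 4 * k * (q : ℝ) ^ (k / 2) := by rw [hε, div_mul_cancel₀ _ hQp.ne']
  have hε0 : 0 < ε := by rw [hε]; positivity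
  have hε1 : ε ≤ 1 / 1000 := by
    rw [hε, div_le_iff₀ hQp]; linarith
  have hkε : (k : ℝ) ≤ ε * Q := by rw [hεQ]; linarith
  have hkm : k * (q : ℝ) ^ m ≤ ε * Q * Δ := by
    rw [hεQ]
    have : k * (q : ℝ) ^ m ≤ k * (4 * (q : ℝ) ^ (k / 2) * Δ) := by gcongr
    linarith
  have hb0 : 0 < b := by linarith
  obtain ⟨g1, g2⟩ := relClose_value_gap (k := k) hQp hε0 hε1 hkε hΔ0 hA hB hα hβ
    (Bα := (corrPoly w').eval α)
    (by
      have h1 : k * (q : ℝ) ^ m * (q - α) ≤ ε * Q * Δ * (q - α) :=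
        mul_le_mul_of_nonneg_right hkm (by linarith)
      refine le_trans (le_of_eq ?_) (hDlip.trans h1)
      rw [hΔ])
    exx
  have g3 := relClose_derivative_gap (k := k) hQp (by linarith) hε0 hε1 hkε hΔ0 hB hβ g1 g2 hdA0
    hdA (hDder.trans hkm) hdlip
  have g4 := (relClose_value (k := k) hQp (by linarith) hkε hε0 ha hA hα ea hdA0 hdA).1
  obtain ⟨g5, g6⟩ := relClose_value (k := k) hQp (by linarith) hkε hε0 hb hB hβ eb hdB0 hdB
  have h216 : 864 * (k * (q : ℝ) ^ (k / 2) / Q) = 216 * ε := by rw [hε]; ring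
  rw [h216]
  exact relClose_crossing hq' hQp hε1 (hk1.trans hkε) hΔ0 hab ha hA hB hα hβ g1 g4 g5 g3 g6

end

theorem RelClose.exists_eq_mul {e x y : ℝ} (h : RelClose e x y) (hy : 0 < y) :
    ∃ θ : ℝ, |θ| ≤ e ∧ x = y * (1 + θ) := by
  refine ⟨x / y - 1, ?_, ?_⟩
  · rw [div_sub_one hy.ne', abs_div, abs_of_pos hy, div_le_iff₀ hy]
    exact h
  · rw [add_sub_cancel, mul_div_cancel₀ _ hy.ne']

theorem mainTheorem3 :
    ∃ (k₀ : ℕ) (K : ℝ), ∀ (q k : ℕ), 2 ≤ q → k₀ ≤ k →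
      ∀ (w w' : List (Fin q)), w.length = k → w'.length = k →
        corrValue w' < corrValue w →
        (∃ α c : ℝ, IsMainExponent w α c) ∧
        (∃ α' c' : ℝ, IsMainExponent w' α' c') ∧
        (Real.log q / q ≤ ratioConst w w' ∧ ratioConst w w' ≤ 1) ∧
        ∀ (α c α' c' : ℝ), IsMainExponent w α c → IsMainExponent w' α' c' →
          ∃ n θ : ℝ,
            (∀ t : ℝ, c * α ^ t = c' * α' ^ t ↔ t = n) ∧
            |θ| ≤ K * ((k : ℝ) * (q : ℝ) ^ (-(k : ℝ) / 3 + 4)) ∧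
            n = ratioConst w w' * ((q : ℝ) * (corrPoly w).eval (q : ℝ)) * (1 + θ) ∧
            Real.log q * (q : ℝ) ^ (k - 1) * (1 + θ) ≤ n := by
  -- From `k = 42` on, `mul_pow_half_le` makes $\varepsilon\le1/1000$; and $864=4\cdot216$.
  refine ⟨42, 864, fun q k hq hk w w' hw hw' hlt => ?_⟩
  have hq' : (2 : ℝ) ≤ q := by exact_mod_cast hq
  obtain ⟨m, -, -, hgap1, -⟩ := exists_corrPoly_gap hq hw hw' hlt
  obtain ⟨hr0, hr1⟩ := relGap_bounds hq (by omega) (by omega) hgap1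
  have hC := ratioConst_bounds hq hr0 hr1
  have hsmall := mul_pow_half_le hq hk
  have hk0 : (0 : ℝ) ≤ k := Nat.cast_nonneg k
  have h64 : 64 * (k : ℝ) ≤ (q : ℝ) ^ (k - 1) := by
    have : (k : ℝ) ≤ k * (q : ℝ) ^ (k / 2) :=
      le_mul_of_one_le_right (by positivity) (one_le_pow₀ (by linarith))
    linarith
  obtain ⟨Q, hQ⟩ : ∃ Q : ℝ, Q = (q : ℝ) ^ (k - 1) := ⟨_, rfl⟩
  obtain ⟨α, hα0, hαq, hα, hA, hdA, hmain⟩ := exists_isMainExponent (w := w) hq (by omega)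
    (by rw [hw]; exact h64)
  obtain ⟨β, hβ0, hβq, hβ, hB, hdB, hmain'⟩ := exists_isMainExponent (w := w') hq (by omega)
    (by rw [hw']; exact h64)
  refine ⟨⟨α, _, (hmain _ _).2 ⟨rfl, rfl⟩⟩, ⟨β, _, (hmain' _ _).2 ⟨rfl, rfl⟩⟩, hC, ?_⟩
  intro x c x' c' hx hx'
  obtain ⟨rfl, rfl⟩ := (hmain _ _).1 hx
  obtain ⟨rfl, rfl⟩ := (hmain' _ _).1 hx'
  rw [hw, ← hQ] at hA hdA
  rw [hw', ← hQ] at hB hdB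
  have ha := pow_le_eval_corrPoly (w := w) (by omega) (Nat.cast_nonneg (α := ℝ) q)
  have hb := pow_le_eval_corrPoly (w := w') (by omega) (Nat.cast_nonneg (α := ℝ) q)
  rw [hw, ← hQ] at ha
  rw [hw', ← hQ] at hb
  have hQp : 0 < Q := by rw [hQ]; positivity
  have hab : (corrPoly w).eval (q : ℝ) - (corrPoly w').eval (q : ℝ) ≤
      (corrPoly w').eval (q : ℝ) := by
    have h1 : relGap w w' ≤ 1 := by nlinarith
    rwa [relGap, div_le_one (by linarith)] at h1
  obtain ⟨hH, hHG, hx0, hxx, hclose⟩ := relClose_word_crossing hq hk hw hw' hlt hQ hab hα0 hαq hα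
    hA hdA hβ0 hβq hβ hB hdB
  have hlogq : 0 < Real.log q := Real.log_pos (by linarith)
  have hX : 0 < ratioConst w w' * (q * (corrPoly w).eval (q : ℝ)) := by
    have h1 : 0 < (corrPoly w).eval (q : ℝ) := by linarith
    have h2 : 0 < ratioConst w w' := lt_of_lt_of_le (by positivity) hC.1
    positivity
  obtain ⟨θ, hθ, hn⟩ := hclose.exists_eq_mul hX
  refine ⟨_, θ, mul_rpow_eq_iff hx0 hxx (hH.trans hHG) hH, hθ.trans ?_, hn, ?_⟩
  · have h1 := pow_half_div_le hq (by omega : 1 ≤ k)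
    rw [← hQ] at h1
    rw [mul_div_assoc]
    gcongr
  · rw [hn]
    -- Needed so that `1 + θ` is nonnegative and the bound on the main term can be multiplied by it.
    have hθ1 : |θ| ≤ 1 := hθ.trans (by
      rw [← hQ] at hsmall
      rw [mul_div_assoc', div_le_one hQp]
      have : (0 : ℝ) ≤ k * (q : ℝ) ^ (k / 2) := by positivity
      linarith)
    refine mul_le_mul_of_nonneg_right ?_ (by linarith [(abs_le.1 hθ1).1])
    have h2 : Real.log q ≤ ratioConst w w' * q := (div_le_iff₀ (by linarith)).1 hC.1
    rw [← hQ, ← mul_assoc]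
    exact mul_le_mul h2 ha hQp.le (hlogq.le.trans h2)
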